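/- Let $k\ge 2$. A $k$-uniform supertree is a finite $k$-uniform hypergraph (without multiple edges) that is connected and has no cycle; a cycle is a sequence $(u_1,e_1,u_2,e_2,\dots,u_p,e_p,u_1)$ with $p\ge 2$, distinct vertices $u_1,\dots,u_p$ and distinct edges $e_1,\dots,e_p$ such that $u_i,u_{i+1}\in e_i$ for all $i$ (where $u_{p+1}=u_1$). Its boundary $\partial V$ is the set of vertices of degree one, and the other vertices form its interior $V^\circ$. Its Laplacian is $L=D-A$, where $D$ is the diagonal matrix of vertex degrees and $A_{ij}=\sum_{e\supseteq\{i,j\}}\frac{1}{|e|-1}$ for $i\ne j$, $A_{ii}=0$. A real number $\lambda$ is a Dirichlet eigenvalue of $\mathcal G$ if there is a non-zero $f:V\to\mathbb R$ with $(L f)(u)=\lambda f(u)$ for all $u\in V^\circ$ and $f(u)=0$ for all $u\in\partial V$; the smallest one is denoted $\lambda(\mathcal G)$. The degree sequence of a supertree with $n$ vertices and $n_0$ interior vertices is written $\pi=(d_0,\dots,d_{n_0-1},\dots,d_{n-1})$, where $d_0\le\dots\le d_{n_0-1}$ are the degrees of the interior vertices and $d_{n_0}=\dots=d_{n-1}=1$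 are those of the boundary vertices. Let $\mathcal T_\pi$ be the class of all $k$-uniform supertrees with degree sequence $\pi$. A supertree $\mathcal G\in\mathcal T_\pi$ has the Faber–Krahn property in $\mathcal T_\pi$ if $\lambda(\mathcal G)\le\lambda(\mathcal H)$ for all $\mathcal H\in\mathcal T_\pi$. For two such sequences of length $n$ write $\pi'\triangleleft\pi$ ($\pi'$ is majorized by $\pi$) if $\sum_{i=0}^{j}d'_i\le\sum_{i=0}^{j}d_i$ for all $0\le j\le n-2$ and $\sum_{i=0}^{n-1}d'_i=\sum_{i=0}^{n-1}d_i$. Let $\pi$ and $\pi'$ be degree sequences of $k$-uniform supertrees with the same number $n$ of vertices and the same number $n_0$ of interior vertices, and let $\mathcal G$ and $\mathcal G'$ have the Faber–Krahn property in $\mathcal T_\pi$ and $\mathcal T_{\pi'}$, respectively. If $\pi'\triangleleft\pi$ and $\pi\ne\pi'$, then $\lambda(\mathcal G')<\lambda(\mathcal G)$. -/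

import Mathlib

/-!
Supertrees with boundary, their Dirichlet eigenvalues, and majorization of degree sequences.
Mathlib's `Hypergraph V` has a vertex set and a set of edges (no repeated edges).
-/

namespace Hypergraph

variable {V : Type*}

/-- Every edge has exactly `k` vertices. -/
def IsUniform (G : Hypergraph V) (k : ℕ) : Prop :=
  ∀ e ∈ G.edgeSet, e.Finite ∧ e.ncard = k

/-- The number of edges that contain `v`. -/
noncomputable def degree (G : Hypergraph V) (v : V) : ℕ :=
  {e | e ∈ G.edgeSet ∧ v ∈ e}.ncard

/-- `(u 0, e 0, u 1, e 1, …, e (p - 1), u p)` is a path: the vertices are distinct, the edges are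
distinct, and `e i` contains `u i` and `u (i + 1)`. -/
structure IsPath (G : Hypergraph V) {p : ℕ} (u : Fin (p + 1) → V) (e : Fin p → Set V) : Prop where
  vertex_mem : ∀ i, u i ∈ G.vertexSet
  vertex_injective : Function.Injective u
  edge_injective : Function.Injective e
  edge_mem : ∀ i, e i ∈ G.edgeSet
  left_mem : ∀ i : Fin p, u i.castSucc ∈ e i
  right_mem : ∀ i : Fin p, u i.succ ∈ e i

/-- `(u 0, e 0, u 1, e 1, …, e (p - 1), u p)` with `u p = u 0` is a cycle (of length `p ≥ 2`):
apart from `u p = u 0` the vertices are distinct, the edges are distinct, and `e i` contains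
`u i` and `u (i + 1)`. -/
structure IsCycle (G : Hypergraph V) {p : ℕ} (u : Fin (p + 1) → V) (e : Fin p → Set V) : Prop where
  two_le : 2 ≤ p
  closed : u (Fin.last p) = u 0
  vertex_injective : Function.Injective fun i : Fin p => u i.castSucc
  edge_injective : Function.Injective e
  edge_mem : ∀ i, e i ∈ G.edgeSet
  left_mem : ∀ i : Fin p, u i.castSucc ∈ e i
  right_mem : ∀ i : Fin p, u i.succ ∈ e i

/-- There is a vertex, and any two vertices are the ends of a path. -/
def IsConnected (G : Hypergraph V) : Prop :=
  G.vertexSet.Nonempty ∧ ∀ x ∈ G.vertexSet, ∀ y ∈ G.vertexSet,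
    ∃ (p : ℕ) (u : Fin (p + 1) → V) (e : Fin p → Set V),
      G.IsPath u e ∧ u 0 = x ∧ u (Fin.last p) = y

/-- There is no cycle. -/
def IsAcyclic (G : Hypergraph V) : Prop :=
  ∀ (p : ℕ) (u : Fin (p + 1) → V) (e : Fin p → Set V), ¬ G.IsCycle u e

/-- A `k`-uniform supertree whose set of vertices is all of `V`. -/
structure IsSupertree (G : Hypergraph V) (k : ℕ) : Prop where
  vertexSet_eq : G.vertexSet = Set.univ
  uniform : G.IsUniform k
  connected : G.IsConnected
  acyclic : G.IsAcyclic

/-- The boundary: the vertices of degree one. -/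
def boundary (G : Hypergraph V) : Set V := {v | v ∈ G.vertexSet ∧ G.degree v = 1}

/-- The interior vertices: those that are not boundary vertices. -/
def interior (G : Hypergraph V) : Set V := {v | v ∈ G.vertexSet ∧ v ∉ G.boundary}

open Classical in
/-- The adjacency matrix: for `i ≠ j` the entry is the sum of `1 / (|e| - 1)` over the edges `e`
that contain both `i` and `j`, which is `0` if `i` and `j` are not adjacent. -/
noncomputable def adjMatrix (G : Hypergraph V) : Matrix V V ℝ :=
  Matrix.of fun i j => if i = j then 0 else
    ∑ᶠ e ∈ {e | e ∈ G.edgeSet ∧ i ∈ e ∧ j ∈ e}, 1 / ((e.ncard : ℝ) - 1)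

open Classical in
/-- The Laplacian matrix: the diagonal matrix of degrees minus the adjacency matrix. -/
noncomputable def lapMatrix (G : Hypergraph V) : Matrix V V ℝ :=
  Matrix.diagonal (fun v => (G.degree v : ℝ)) - G.adjMatrix

theorem lapMatrix_symm (G : Hypergraph V) (i j : V) : G.lapMatrix i j = G.lapMatrix j i := by
  by_cases h : i = j
  · rw [h]
  · have h2 : j ≠ i := fun h3 => h h3.symm
    simp [lapMatrix, adjMatrix, Matrix.diagonal, h, h2, and_comm]

section Dirichlet

variable [Fintype V]

/-- `f`, a function on the vertices (continued by zero outside the vertex set), is a Dirichlet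
eigenfunction for `μ`. -/
structure IsDirichletEigenfunction (G : Hypergraph V) (μ : ℝ) (f : V → ℝ) : Prop where
  ne_zero : f ≠ 0
  eq_zero_of_notMem : ∀ u ∉ G.vertexSet, f u = 0
  eigen : ∀ u ∈ G.interior, G.lapMatrix.mulVec f u = μ * f u
  boundary_eq_zero : ∀ u ∈ G.boundary, f u = 0

/-- `μ` is a Dirichlet eigenvalue. -/
def IsDirichletEigenvalue (G : Hypergraph V) (μ : ℝ) : Prop :=
  ∃ f : V → ℝ, G.IsDirichletEigenfunction μ f

/-- The first (that is, the smallest) Dirichlet eigenvalue; the minimum is attained as soon as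
there is an interior vertex, see `isLeast_firstDirichletEigenvalue`. -/
noncomputable def firstDirichletEigenvalue (G : Hypergraph V) : ℝ :=
  sInf {μ | G.IsDirichletEigenvalue μ}

open Classical in
theorem isDirichletEigenvalue_iff (G : Hypergraph V) (μ : ℝ) :
    G.IsDirichletEigenvalue μ ↔ ∃ g : G.interior → ℝ, g ≠ 0 ∧
      (G.lapMatrix.submatrix (Subtype.val : G.interior → V) Subtype.val).mulVec g = μ • g := by
  have key : ∀ f : V → ℝ, (∀ u, u ∉ G.interior → f u = 0) → ∀ u : G.interior,
      G.lapMatrix.mulVec f u =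
        (G.lapMatrix.submatrix (Subtype.val : G.interior → V) Subtype.val).mulVec
          (fun v : G.interior => f v) u := by
    intro f hf u
    simp only [Matrix.mulVec, dotProduct, Matrix.submatrix_apply]
    rw [← Finset.sum_subset (Finset.subset_univ (Finset.univ.filter (· ∈ G.interior)))
      (fun x _ hx => by
        rw [hf x (fun h => hx (Finset.mem_filter.mpr ⟨Finset.mem_univ x, h⟩)), mul_zero])]
    exact Finset.sum_subtype _ (fun x => by simp) _
  constructor
  · rintro ⟨f, hf⟩
    have hz : ∀ u, u ∉ G.interior → f u = 0 := by
      intro u hu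
      by_cases h : u ∈ G.vertexSet
      · exact hf.boundary_eq_zero u (by_contra fun h2 => hu ⟨h, h2⟩)
      · exact hf.eq_zero_of_notMem u h
    refine ⟨fun v => f v, fun h => hf.ne_zero ?_, ?_⟩
    · funext u
      by_cases hu : u ∈ G.interior
      · exact congrFun h ⟨u, hu⟩
      · exact hz u hu
    · funext u
      rw [← key f hz u, hf.eigen u u.2]
      rfl
  · rintro ⟨g, hg, hgμ⟩
    have hz : ∀ u, u ∉ G.interior →
        (fun v => if h : v ∈ G.interior then g ⟨v, h⟩ else 0) u = 0 := by
      intro u hu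
      simp [hu]
    have hgf : (fun v : G.interior =>
        (fun v => if h : v ∈ G.interior then g ⟨v, h⟩ else 0) (v : V)) = g := by
      funext v
      simp
    refine ⟨fun v => if h : v ∈ G.interior then g ⟨v, h⟩ else 0, ?_, ?_, ?_, ?_⟩
    · intro h
      apply hg
      rw [← hgf]
      funext v
      exact congrFun h v
    · exact fun u hu => hz u (fun h => hu h.1)
    · intro u hu
      rw [key _ hz ⟨u, hu⟩, hgf, hgμ]
      simp [hu]
    · exact fun u hu => hz u (fun h => h.2 hu)

/-- If there is an interior vertex, the first Dirichlet eigenvalue is a Dirichlet eigenvalue, and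
the least one. -/
theorem isLeast_firstDirichletEigenvalue (G : Hypergraph V) (h : G.interior.Nonempty) :
    IsLeast {μ | G.IsDirichletEigenvalue μ} G.firstDirichletEigenvalue := by
  classical
  have : Nonempty G.interior := h.to_subtype
  set M := G.lapMatrix.submatrix (Subtype.val : G.interior → V) Subtype.val with hM
  have hH : M.IsHermitian := by
    ext i j
    simp [hM, G.lapMatrix_symm i j]
  have hfin : {μ | G.IsDirichletEigenvalue μ}.Finite := by
    refine (Module.End.finite_hasEigenvalue (Matrix.toLin' M)).subset fun μ hμ => ?_
    obtain ⟨g, hg, hgμ⟩ := (G.isDirichletEigenvalue_iff μ).mp hμ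
    exact Module.End.hasEigenvalue_of_hasEigenvector (x := g)
      ⟨Module.End.mem_eigenspace_iff.mpr (by rw [Matrix.toLin'_apply, hgμ]), hg⟩
  have hne : {μ | G.IsDirichletEigenvalue μ}.Nonempty := by
    let i : G.interior := Classical.arbitrary _
    refine ⟨hH.eigenvalues i, (G.isDirichletEigenvalue_iff _).mpr
      ⟨WithLp.ofLp (hH.eigenvectorBasis i), fun h0 => ?_, hH.mulVec_eigenvectorBasis i⟩⟩
    exact hH.eigenvectorBasis.orthonormal.ne_zero i (WithLp.ofLp_injective 2 h0)
  exact ⟨hne.csInf_mem hfin, fun μ hμ => csInf_le hfin.bddBelow hμ⟩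

end Dirichlet

/-- `π = (d_0, …, d_{n-1})` is the degree sequence of `G`, which has `n₀` interior vertices: the
first `n₀` entries are the degrees of the interior vertices in non-decreasing order, the other
entries are the degrees of the boundary vertices. -/
def IsDegreeSequence (G : Hypergraph V) {n : ℕ} (n₀ : ℕ) (π : Fin n → ℕ) : Prop :=
  ∃ σ : Fin n ≃ V, (∀ i, G.degree (σ i) = π i) ∧
    (∀ i : Fin n, (i : ℕ) < n₀ ↔ σ i ∈ G.interior) ∧
    (∀ i j : Fin n, i ≤ j → (j : ℕ) < n₀ → π i ≤ π j)

/-- The class of all `k`-uniform supertrees on the vertex set `V` with degree sequence `π`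
(and `n₀` interior vertices, a number that `π` determines). -/
def supertreesOfDegreeSequence (V : Type*) (k : ℕ) {n : ℕ} (n₀ : ℕ) (π : Fin n → ℕ) :
    Set (Hypergraph V) :=
  {G | G.IsSupertree k ∧ G.IsDegreeSequence n₀ π}

/-- `G` has the Faber–Krahn property in the class `C`: it lies in `C` and its first Dirichlet
eigenvalue is minimal in `C`. -/
def HasFaberKrahnProperty [Fintype V] (G : Hypergraph V) (C : Set (Hypergraph V)) : Prop :=
  G ∈ C ∧ ∀ H ∈ C, G.firstDirichletEigenvalue ≤ H.firstDirichletEigenvalue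

end Hypergraph

/-- `π` is majorized by `π'`: the partial sums of `π`, in the given order, are at most those of
`π'`, and the total sums agree. -/
def IsMajorizedBy {n : ℕ} (π π' : Fin n → ℕ) : Prop :=
  (∀ j : Fin n, (j : ℕ) + 2 ≤ n → ∑ i ∈ Finset.Iic j, π i ≤ ∑ i ∈ Finset.Iic j, π' i) ∧
    ∑ i, π i = ∑ i, π' i

/-! Write `k = K + 1`. Start from a non-negative first eigenfunction `f` of `G` and number the
vertices by decreasing `f`, interior vertices first. Once a supertree is rooted, every vertex but
the root is a child in exactly one edge, and the degrees say in how many edges a vertex is the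
parent. With `P b` the value at the parent of edge `b` and `a (b, s)` those at its children, `K`
times the quadratic form of `L` is `K ∑ P² + (K + 1) ∑ a² - 2 ∑ P a - ∑ (block sums of a)²`.

Two operations do not raise this energy. One is the sorting of children: if parents and blocks of
children both decrease, the two subtracted sums are maximal (`familyEnergy_le_comp_perm`, from the
rearrangement inequality). The other is the replacement of parents by parents with smaller values
that still dominate their children; the energy then drops by at least `K ∑ (P - P')²`
(`familyEnergy_add_le`).

The comparison tree is the block tree: consecutive blocks of `K` numbers are the children of
successive edges, and parents are used up in increasing order. The increasing degree order has the
smallest partial sums and hence the latest parents, so both operations lead from `G` to the block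
tree of `π` (`IsSupertree.exists_energy_le`). As `G` is minimal, this tree has the same first
eigenvalue and the rearranged `f` is its eigenfunction.

Majorization moves parents further back in the block tree of `π'`, so the second operation gives
`λ(G') ≤ λ(G)`. Equality would make the parent values agree and the same function an eigenfunction
of both block trees. `IsBlockEigenfunction.par_eq` then forces equal parents: at the first
discrepancy, the difference of the two eigenvalue equations makes a whole block constant, and the
second equation contradicts positivity of the eigenvalue and of the interior values. Equal parents
mean equal degrees, against `π ≠ π'`. -/

namespace Hypergraph

/-! ### Paths, cycles, and rooting a supertree. -/

/-- A path of length `p` whose edges belong to `F`, indexed by natural numbers. -/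
structure IsPathIn {V : Type*} (F : Set (Set V)) (p : ℕ) (u : ℕ → V) (e : ℕ → Set V) : Prop where
  vertex_inj : ∀ i ≤ p, ∀ j ≤ p, u i = u j → i = j
  edge_inj : ∀ i < p, ∀ j < p, e i = e j → i = j
  edge_mem : ∀ i < p, e i ∈ F
  left_mem : ∀ i < p, u i ∈ e i
  right_mem : ∀ i < p, u (i + 1) ∈ e i

/-- Two vertices lie in a common member of `F`. -/
def AdjIn {V : Type*} (F : Set (Set V)) (x y : V) : Prop := ∃ e ∈ F, x ∈ e ∧ y ∈ e

theorem IsPathIn.truncate {V : Type*} {F : Set (Set V)} {p q : ℕ} {u : ℕ → V} {e : ℕ → Set V}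
    (h : IsPathIn F p u e) (hq : q ≤ p) : IsPathIn F q u e where
  vertex_inj i hi j hj := h.vertex_inj i (hi.trans hq) j (hj.trans hq)
  edge_inj i hi j hj := h.edge_inj i (hi.trans_le hq) j (hj.trans_le hq)
  edge_mem i hi := h.edge_mem i (hi.trans_le hq)
  left_mem i hi := h.left_mem i (hi.trans_le hq)
  right_mem i hi := h.right_mem i (hi.trans_le hq)

/-- Vertices connected through members of `F` are the ends of a path in `F`. -/
theorem exists_isPathIn {V : Type*} {F : Set (Set V)} {x y : V}
    (h : Relation.ReflTransGen (AdjIn F) x y) :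
    ∃ (p : ℕ) (u : ℕ → V) (e : ℕ → Set V), IsPathIn F p u e ∧ u 0 = x ∧ u p = y := by
  classical
  induction h with
  | refl =>
    exact ⟨0, fun _ => x, fun _ => ∅, ⟨by grind, by grind, by grind, by grind, by grind⟩, rfl, rfl⟩
  | @tail y z _ hyz ih =>
    obtain ⟨p, u, e, hp, h0, hy⟩ := ih
    obtain ⟨s, hs, hys, hzs⟩ := hyz
    by_cases hz : ∃ i ≤ p, u i = z
    · obtain ⟨i, hi, hiz⟩ := hz
      exact ⟨i, u, e, hp.truncate hi, h0, hiz⟩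
    · push Not at hz
      -- The path is cut at its first vertex in `s`; no edge kept can then be `s` itself.
      have hex : ∃ i, i ≤ p ∧ u i ∈ s := ⟨p, le_rfl, hy ▸ hys⟩
      obtain ⟨hi, his⟩ := Nat.find_spec hex
      have hmin : ∀ j < Nat.find hex, u j ∉ s := fun j hj hjs =>
        Nat.find_min hex hj ⟨by omega, hjs⟩
      generalize Nat.find hex = i at hi his hmin
      have hne : ∀ j < i, e j ≠ s := fun j hj hjs =>
        hmin j hj (hjs ▸ hp.left_mem j (by omega))
      refine ⟨i + 1, fun j => if j ≤ i then u j else z, fun j => if j < i then e j else s,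
        ⟨?_, ?_, ?_, ?_, ?_⟩, by simpa using h0, by simp⟩
      · intro a ha b hb hab
        have := hp.vertex_inj a
        have := hz a
        have := hz b
        grind
      · intro a ha b hb hab
        have := hp.edge_inj a
        have := hne a
        have := hne b
        grind
      · intro a ha
        have := hp.edge_mem a
        grind
      · intro a ha
        have := hp.left_mem a
        grind
      · intro a ha
        have := hp.right_mem a
        grind

/-- An edge outside `F` that meets a path in `F` at both ends closes a cycle. -/
theorem IsAcyclic.eq_of_reflTransGen {V : Type*} {G : Hypergraph V} (hG : G.IsAcyclic)
    {F : Set (Set V)} (hF : F ⊆ G.edgeSet) {s : Set V} (hs : s ∈ G.edgeSet) (hsF : s ∉ F)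
    {x y : V} (hx : x ∈ s) (hy : y ∈ s) (h : Relation.ReflTransGen (AdjIn F) x y) : x = y := by
  obtain ⟨p, u, e, hp, h0, hpy⟩ := exists_isPathIn h
  by_contra hxy
  have hp0 : p ≠ 0 := by rintro rfl; exact hxy (h0.symm.trans hpy)
  -- Here `p ≥ 1`, so the closed path has length at least two. The default values are the closing
  -- edge `s` and the repeated start `x`.
  refine hG (p + 1) (fun i => if (i : ℕ) ≤ p then u i else x)
    (fun i => if (i : ℕ) < p then e i else s) ⟨by omega, ?_, ?_, ?_, ?_, ?_, ?_⟩
  · simp [h0]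
  · intro a b hab
    have ha := a.2
    have hb := b.2
    have := hp.vertex_inj a (by omega) b (by omega)
    simp only [Fin.val_castSucc] at hab
    rw [if_pos (by omega), if_pos (by omega)] at hab
    exact Fin.ext (this hab)
  · intro a b hab
    have ha := a.2
    have hb := b.2
    have h1 := hp.edge_inj a
    have h2 := hp.edge_mem a
    have h3 := hp.edge_mem b
    apply Fin.ext
    grind
  · intro a
    have h2 := hp.edge_mem a
    have := @hF (e a)
    grind
  · intro a
    have ha := a.2
    simp only [Fin.val_castSucc]
    have hap : (a : ℕ) ≤ p := by omega
    rw [if_pos hap]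
    split_ifs with hap'
    · exact hp.left_mem a hap'
    · rwa [show (a : ℕ) = p by omega, hpy]
  · intro a
    have ha := a.2
    simp only [Fin.val_succ]
    by_cases hap : (a : ℕ) < p
    · have hap' : (a : ℕ) + 1 ≤ p := hap
      rw [if_pos hap', if_pos hap]
      exact hp.right_mem a hap
    · have hap' : ¬ (a : ℕ) + 1 ≤ p := hap
      rwa [if_neg hap', if_neg hap]

/-- A set `F` of edges grown from the root `r`: the function `par` picks from each edge its
vertex closest to the root. -/
structure IsRootedForest {V : Type*} (F : Set (Set V)) (r : V) (par : Set V → V) : Prop where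
  par_mem : ∀ e ∈ F, par e ∈ e
  par_root : ∀ e ∈ F, r ∈ e → par e = r
  unique : ∀ e ∈ F, ∀ e' ∈ F, ∀ v ∈ e, v ∈ e' → par e ≠ v → par e' ≠ v → e = e'
  exists_child : ∀ e ∈ F, ∀ v ∈ e, v ≠ r → ∃ e' ∈ F, v ∈ e' ∧ par e' ≠ v
  connected : ∀ e ∈ F, ∀ v ∈ e, Relation.ReflTransGen (AdjIn F) r v

theorem reflTransGen_adjIn_symm {V : Type*} {F : Set (Set V)} {x y : V}
    (h : Relation.ReflTransGen (AdjIn F) x y) : Relation.ReflTransGen (AdjIn F) y x := by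
  have : Std.Symm (AdjIn F) := ⟨fun _ _ ⟨e, h, h1, h2⟩ => ⟨e, h, h2, h1⟩⟩
  exact Std.Symm.symm _ _ h

theorem reflTransGen_adjIn_mono {V : Type*} {F F' : Set (Set V)} (h : F ⊆ F') {x y : V}
    (hxy : Relation.ReflTransGen (AdjIn F) x y) : Relation.ReflTransGen (AdjIn F') x y :=
  Relation.ReflTransGen.mono (fun _ _ ⟨e, he, h1⟩ => ⟨e, h he, h1⟩) _ _ hxy

/-- A supertree can be rooted at any vertex. -/
theorem IsSupertree.exists_isRootedForest {V : Type*} [Finite V] {G : Hypergraph V} {k : ℕ}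
    (hk : k ≠ 0) (hG : G.IsSupertree k) (r : V) :
    ∃ par, IsRootedForest G.edgeSet r par ∧ ∀ v ≠ r, ∃ e ∈ G.edgeSet, v ∈ e ∧ par e ≠ v := by
  classical
  -- A maximal rooted set of edges contains each edge that touches a reached vertex, and by
  -- connectedness it is everything.
  have hfin : {F | F ⊆ G.edgeSet ∧ ∃ par, IsRootedForest F r par}.Finite := Set.toFinite _
  obtain ⟨F, ⟨hFE, par, hF⟩, hmax⟩ := hfin.exists_maximal
    ⟨∅, Set.empty_subset _, fun _ => r, by constructor <;> simp⟩
  have hconn : ∀ v, v = r ∨ (∃ e ∈ F, v ∈ e) → Relation.ReflTransGen (AdjIn F) r v := by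
    rintro v (rfl | ⟨e, he, hv⟩)
    · exact .refl
    · exact hF.connected e he v hv
  have hgrow : ∀ s ∈ G.edgeSet, ∀ q ∈ s, (q = r ∨ ∃ e ∈ F, q ∈ e) → s ∈ F := by
    intro s hs q hq hqW
    by_contra hsF
    -- Acyclicity: a new edge meets the reached vertices in `q` alone, so `q` can serve as its
    -- parent and its other vertices are new.
    have huniq : ∀ v ∈ s, (v = r ∨ ∃ e ∈ F, v ∈ e) → v = q := fun v hv hvW =>
      hG.acyclic.eq_of_reflTransGen hFE hs hsF hv hq
        ((reflTransGen_adjIn_symm (hconn v hvW)).trans (hconn q hqW))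
    have hq1 : q ≠ r → ∃ e ∈ F, q ∈ e := fun h => hqW.resolve_left h
    have key : IsRootedForest (insert s F) r (Function.update par s q) := by
      have hne : ∀ e ∈ F, e ≠ s := fun e he h => hsF (h ▸ he)
      have hup : ∀ e ∈ F, Function.update par s q e = par e := fun e he =>
        Function.update_of_ne (hne e he) _ _
      have hus : Function.update par s q s = q := Function.update_self _ _ _
      have hmono := @reflTransGen_adjIn_mono V F (insert s F) (Set.subset_insert _ _)
      constructor
      · rintro e (rfl | he)
        · rwa [hus]
        · rw [hup e he]; exact hF.par_mem e he
      · rintro e (rfl | he) hr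
        · rw [hus]; exact (huniq r hr (.inl rfl)).symm
        · rw [hup e he]; exact hF.par_root e he hr
      · rintro e (rfl | he) e' (rfl | he') v hv hv' h1 h2
        · rfl
        · exact absurd (huniq v hv (.inr ⟨e', he', hv'⟩)).symm (by rwa [hus] at h1)
        · exact absurd (huniq v hv' (.inr ⟨e, he, hv⟩)).symm (by rwa [hus] at h2)
        · rw [hup e he] at h1
          rw [hup e' he'] at h2
          exact hF.unique e he e' he' v hv hv' h1 h2
      · have hold : ∀ e ∈ F, ∀ v ∈ e, v ≠ r →
            ∃ e' ∈ insert s F, v ∈ e' ∧ Function.update par s q e' ≠ v := by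
          intro e he v hv hvr
          obtain ⟨e', he', h1, h2⟩ := hF.exists_child e he v hv hvr
          exact ⟨e', .inr he', h1, by rwa [hup e' he']⟩
        rintro e (rfl | he) v hv hvr
        · by_cases hvq : v = q
          · obtain ⟨e, he, h⟩ := hq1 (hvq ▸ hvr)
            exact hold e he v (hvq ▸ h) hvr
          · exact ⟨_, .inl rfl, hv, by rw [hus]; exact fun h => hvq h.symm⟩
        · exact hold e he v hv hvr
      · rintro e (rfl | he) v hv
        · exact (hmono (hconn q hqW)).tail ⟨_, .inl rfl, hq, hv⟩
        · exact hmono (hF.connected e he v hv)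
    exact hsF (hmax (y := insert s F) ⟨Set.insert_subset hs hFE, _, key⟩ (Set.subset_insert _ _)
      (.inl rfl))
  have hW : ∀ v, v = r ∨ ∃ e ∈ F, v ∈ e := by
    intro v
    obtain ⟨p, u, e, hp, h0, hv⟩ := hG.connected.2 r (by simp [hG.vertexSet_eq]) v
      (by simp [hG.vertexSet_eq])
    have : ∀ i : Fin (p + 1), u i = r ∨ ∃ e ∈ F, u i ∈ e := by
      intro i
      induction i using Fin.induction with
      | zero => exact .inl h0
      | succ i ih =>
        exact .inr ⟨e i, hgrow _ (hp.edge_mem i) _ (hp.left_mem i) ih, hp.right_mem i⟩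
    exact hv ▸ this _
  have hFeq : F = G.edgeSet := by
    refine hFE.antisymm fun e he => ?_
    obtain ⟨v, hv⟩ : e.Nonempty := by
      rw [← Set.ncard_pos (hG.uniform e he).1, (hG.uniform e he).2]
      omega
    exact hgrow e he v hv (hW v)
  subst hFeq
  refine ⟨par, hF, fun v hv => ?_⟩
  obtain ⟨e, he, h⟩ := (hW v).resolve_left hv
  exact hF.exists_child e he v h hv

/-! ### Rooted descriptions: degrees, Laplacian and energy as sums over edges. -/

/-- The edge with parent `p` and children `c`. -/
def familyEdge {V : Type*} {K : ℕ} (p : V) (c : Fin K → V) : Set V := insert p (Set.range c)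

/-- A description of `G` as a rooted supertree: the edge number `b` consists of its parent
`par b` and its children `ch (b, s)`, and each vertex but the root is a child exactly once. -/
structure IsRootedBy {V : Type*} (G : Hypergraph V) {m K : ℕ} (r : V) (par : Fin m → V)
    (ch : Fin m × Fin K → V) : Prop where
  edgeSet_eq : G.edgeSet = Set.range fun b => familyEdge (par b) fun s => ch (b, s)
  edge_injective : Function.Injective fun b => familyEdge (par b) fun s => ch (b, s)
  ch_injective : Function.Injective ch
  range_ch : Set.range ch = {r}ᶜ
  par_ne : ∀ b s, par b ≠ ch (b, s)

/-- The children of an edge are its vertices other than the parent; the field `unique` of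
`IsRootedForest` makes the child map injective. -/
theorem IsSupertree.exists_isRootedBy {V : Type*} [Finite V] {G : Hypergraph V} {K : ℕ}
    (hG : G.IsSupertree (K + 1)) (r : V) :
    ∃ (m : ℕ) (par : Fin m → V) (ch : Fin m × Fin K → V), G.IsRootedBy r par ch := by
  classical
  obtain ⟨par, hF, hex⟩ := hG.exists_isRootedForest (by omega) r
  have : Finite G.edgeSet := Set.toFinite _
  obtain ⟨m, ⟨ε⟩⟩ := Finite.exists_equiv_fin G.edgeSet
  have hch : ∀ e ∈ G.edgeSet, Nonempty (Fin K ≃ (e \ {par e} : Set V)) := by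
    intro e he
    refine ⟨(Finite.equivFinOfCardEq ?_).symm⟩
    have h1 : (e \ {par e}).ncard = K := by
      rw [Set.ncard_sdiff_singleton_of_mem (hF.par_mem e he), (hG.uniform e he).2]
      rfl
    rw [← h1]; rfl
  let E : Fin m → Set V := fun b => (ε.symm b).1
  have hE : ∀ b, E b ∈ G.edgeSet := fun b => (ε.symm b).2
  let d : ∀ b, Fin K ≃ (E b \ {par (E b)} : Set V) := fun b => Classical.choice (hch _ (hE b))
  have hedge : ∀ b, familyEdge (par (E b)) (fun s => (d b s : V)) = E b := by
    intro b
    have : Set.range (fun s => (d b s : V)) = E b \ {par (E b)} := by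
      ext v
      constructor
      · rintro ⟨s, rfl⟩; exact (d b s).2
      · intro hv; exact ⟨(d b).symm ⟨v, hv⟩, by simp⟩
    rw [familyEdge, this, Set.insert_sdiff_singleton, Set.insert_eq_of_mem (hF.par_mem _ (hE b))]
  have hEinj : Function.Injective E := fun a b h => ε.symm.injective (Subtype.ext h)
  refine ⟨m, fun b => par (E b), fun x => d x.1 x.2, ⟨?_, ?_, ?_, ?_, ?_⟩⟩
  · simp only [hedge]
    ext e
    constructor
    · intro he; exact ⟨ε ⟨e, he⟩, by simp [E]⟩
    · rintro ⟨b, rfl⟩; exact hE b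
  · simp only [hedge]; exact hEinj
  · rintro ⟨a, s⟩ ⟨b, t⟩ h
    simp only at h
    have h1 := (d a s).2
    have h2 := (d b t).2
    have hab : a = b := hEinj (hF.unique _ (hE a) _ (hE b) (d a s) h1.1 (h ▸ h2.1)
      (fun h' => h1.2 h'.symm) (fun h' => h2.2 (h.symm.trans h'.symm)))
    subst hab
    have := (d a).injective (Subtype.ext h)
    rw [this]
  · ext v
    simp only [Set.mem_range, Set.mem_compl_iff, Set.mem_singleton_iff]
    constructor
    · rintro ⟨⟨b, s⟩, rfl⟩ h
      have h1 := (d b s).2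
      exact h1.2 (h.trans (hF.par_root _ (hE b) (h ▸ h1.1)).symm)
    · intro hv
      obtain ⟨e, he, h1, h2⟩ := hex v hv
      have hb : E (ε ⟨e, he⟩) = e := by simp [E]
      have hmem : v ∈ E (ε ⟨e, he⟩) \ {par (E (ε ⟨e, he⟩))} := by
        rw [hb]; exact ⟨h1, fun h => h2 h.symm⟩
      exact ⟨(ε ⟨e, he⟩, (d _).symm ⟨v, hmem⟩), by simp⟩
  · intro b s h
    exact (d b s).2.2 h.symm

namespace IsRootedBy

variable {V : Type*} {G : Hypergraph V} {m K : ℕ} {r : V} {par : Fin m → V}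
  {ch : Fin m × Fin K → V}

/-- Reindexing of the edges. -/
theorem comp_perm (h : G.IsRootedBy r par ch) (τ : Equiv.Perm (Fin m)) :
    G.IsRootedBy r (par ∘ τ) (fun x => ch (τ x.1, x.2)) where
  edgeSet_eq := by
    rw [h.edgeSet_eq]
    exact (τ.surjective.range_comp fun b => familyEdge (par b) fun s => ch (b, s)).symm
  edge_injective := h.edge_injective.comp τ.injective
  ch_injective := by
    rintro ⟨a, s⟩ ⟨b, t⟩ hab
    have := h.ch_injective hab
    simpa using this
  range_ch := by
    rw [← h.range_ch]
    exact (τ.prodCongr (Equiv.refl (Fin K))).surjective.range_comp ch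
  par_ne b s := h.par_ne (τ b) s

/-- The children together are in bijection with the vertices different from the root. -/
noncomputable def chEquiv (h : G.IsRootedBy r par ch) : Fin m × Fin K ≃ {v // v ≠ r} :=
  (Equiv.ofInjective ch h.ch_injective).trans (Equiv.setCongr h.range_ch)

theorem chEquiv_apply (h : G.IsRootedBy r par ch) (x : Fin m × Fin K) :
    (h.chEquiv x : V) = ch x := rfl

theorem card_eq [Fintype V] (h : G.IsRootedBy r par ch) : Fintype.card V = m * K + 1 := by
  classical
  have h1 := Fintype.card_congr h.chEquiv
  rw [Fintype.card_prod, Fintype.card_fin, Fintype.card_fin] at h1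
  have h2 := Fintype.card_subtype_compl (fun v => v = r)
  simp only [Fintype.card_subtype_eq] at h2
  have h3 : 0 < Fintype.card V := Fintype.card_pos_iff.mpr ⟨r⟩
  change Fintype.card {v // v ≠ r} = _ at h2
  omega

open Classical in
/-- Summation over an edge. -/
theorem sum_edge [Fintype V] (h : G.IsRootedBy r par ch) (F : V → ℝ) (b : Fin m) :
    ∑ v, (if v ∈ familyEdge (par b) (fun s => ch (b, s)) then F v else 0) =
      F (par b) + ∑ s, F (ch (b, s)) := by
  have hinj : Function.Injective fun s => ch (b, s) := fun s t hst => by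
    simpa using h.ch_injective hst
  rw [← Finset.sum_filter]
  have : Finset.univ.filter (· ∈ familyEdge (par b) (fun s => ch (b, s))) =
      insert (par b) (Finset.univ.image fun s => ch (b, s)) := by
    ext v; simp [familyEdge]
  rw [this, Finset.sum_insert, Finset.sum_image (fun s _ t _ hst => hinj hst)]
  simp only [Finset.mem_image, Finset.mem_univ, true_and, not_exists]
  exact fun s hs => h.par_ne b s hs.symm

theorem ncard_edge (h : G.IsRootedBy r par ch) (b : Fin m) :
    (familyEdge (par b) (fun s => ch (b, s))).Finite ∧
      (familyEdge (par b) (fun s => ch (b, s))).ncard = K + 1 := by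
  have hinj : Function.Injective fun s => ch (b, s) := fun s t hst => by
    simpa using h.ch_injective hst
  have hfin : (Set.range fun s => ch (b, s)).Finite := Set.finite_range _
  refine ⟨hfin.insert _, ?_⟩
  rw [familyEdge, Set.ncard_insert_of_notMem _ hfin, Set.ncard_range_of_injective hinj]
  · simp
  · rintro ⟨s, hs⟩; exact h.par_ne b s hs.symm

theorem isUniform (h : G.IsRootedBy r par ch) : G.IsUniform (K + 1) := by
  intro e he
  rw [h.edgeSet_eq] at he
  obtain ⟨b, rfl⟩ := he
  exact h.ncard_edge b

open Classical in
theorem ncard_edges (h : G.IsRootedBy r par ch) (p : Set V → Prop) :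
    {e | e ∈ G.edgeSet ∧ p e}.ncard =
      (Finset.univ.filter fun b => p (familyEdge (par b) fun s => ch (b, s))).card := by
  have : {e | e ∈ G.edgeSet ∧ p e} = (fun b => familyEdge (par b) fun s => ch (b, s)) ''
      {b | p (familyEdge (par b) fun s => ch (b, s))} := by
    rw [h.edgeSet_eq]
    ext e
    constructor
    · rintro ⟨⟨b, rfl⟩, hp⟩; exact ⟨b, hp, rfl⟩
    · rintro ⟨b, hp, rfl⟩; exact ⟨⟨b, rfl⟩, hp⟩
  rw [this, Set.ncard_image_of_injective _ h.edge_injective, Set.ncard_eq_toFinset_card']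
  congr 1
  ext; simp

open Classical in
/-- The degree counts the edges in which the vertex is the parent, and the one in which it is
a child. -/
theorem degree_eq (h : G.IsRootedBy r par ch) (v : V) :
    G.degree v = (Finset.univ.filter fun b => par b = v).card + if v = r then 0 else 1 := by
  rw [degree, h.ncard_edges]
  have hsplit : (Finset.univ.filter fun b => v ∈ familyEdge (par b) fun s => ch (b, s)) =
      (Finset.univ.filter fun b => par b = v) ∪
        (Finset.univ.filter fun b => ∃ s, ch (b, s) = v) := by
    ext b; simp [familyEdge, eq_comm]
  rw [hsplit, Finset.card_union_of_disjoint]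
  · congr 1
    split_ifs with hv
    · rw [Finset.card_eq_zero, Finset.filter_eq_empty_iff]
      rintro b - ⟨s, hs⟩
      have : ch (b, s) ∈ ({r} : Set V)ᶜ := h.range_ch ▸ ⟨_, rfl⟩
      exact this (hs.trans hv)
    · obtain ⟨⟨b, s⟩, hb⟩ : v ∈ Set.range ch := by rw [h.range_ch]; exact hv
      rw [Finset.card_eq_one]
      refine ⟨b, ?_⟩
      ext b'
      simp only [Finset.mem_filter, Finset.mem_univ, true_and, Finset.mem_singleton]
      constructor
      · rintro ⟨s', hs'⟩
        have := h.ch_injective (hs'.trans hb.symm)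
        simp at this
        exact this.1
      · rintro rfl; exact ⟨s, hb⟩
  · rw [Finset.disjoint_filter]
    rintro b - hb ⟨s, hs⟩
    exact h.par_ne b s (hb.trans hs.symm)

open Classical in
/-- The Laplacian at `u` is a sum over the edges that contain `u`. -/
theorem mul_lapMatrix_mulVec [Fintype V] (h : G.IsRootedBy r par ch) (hK : K ≠ 0) (f : V → ℝ)
    (u : V) :
    K * G.lapMatrix.mulVec f u =
      ∑ b, if u ∈ familyEdge (par b) (fun s => ch (b, s)) then
        ((K + 1) * f u - (f (par b) + ∑ s, f (ch (b, s)))) else 0 := by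
  have hK' : (K : ℝ) ≠ 0 := by exact_mod_cast hK
  set E : Fin m → Set V := fun b => familyEdge (par b) fun s => ch (b, s) with hE
  -- All edges have `K + 1` vertices, so the factor `K` clears the weights `1 / (|e| - 1)`.
  have hadj : ∀ v, u ≠ v → (K : ℝ) * G.adjMatrix u v =
      ∑ b, if u ∈ E b ∧ v ∈ E b then 1 else 0 := by
    intro v huv
    have h1 : G.adjMatrix u v =
        ∑ᶠ e ∈ {e | e ∈ G.edgeSet ∧ u ∈ e ∧ v ∈ e}, (1 / (K : ℝ)) := by
      simp only [adjMatrix, Matrix.of_apply, if_neg huv]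
      refine finsum_mem_congr rfl fun e he => ?_
      rw [(h.isUniform e he.1).2]
      push_cast; ring
    rw [h1, finsum_mem_eq_finite_toFinset_sum _ (Set.toFinite _), Finset.sum_const,
      ← Set.ncard_eq_toFinset_card, h.ncard_edges, Finset.sum_boole, nsmul_eq_mul]
    field_simp
    congr!
  have hdeg : (G.degree u : ℝ) = ∑ b, if u ∈ E b then 1 else 0 := by
    rw [degree, h.ncard_edges, Finset.sum_boole]
  have hL : ∀ v, (K : ℝ) * (G.lapMatrix u v * f v) =
      ∑ b, if u ∈ E b then ((if v = u then (K + 1) * f u else 0) -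
        (if v ∈ E b then f v else 0)) else 0 := by
    intro v
    by_cases huv : u = v
    · subst huv
      have : G.lapMatrix u u = G.degree u := by simp [lapMatrix, adjMatrix]
      rw [this, hdeg, Finset.sum_mul, Finset.mul_sum]
      refine Finset.sum_congr rfl fun b _ => ?_
      by_cases hu : u ∈ E b
      · simp only [if_pos hu, if_true]; ring
      · simp [hu]
    · have : G.lapMatrix u v = - G.adjMatrix u v := by simp [lapMatrix, huv]
      rw [this, neg_mul, mul_neg, ← mul_assoc, hadj v huv, Finset.sum_mul, ← Finset.sum_neg_distrib]
      refine Finset.sum_congr rfl fun b _ => ?_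
      rw [if_neg (Ne.symm huv)]
      by_cases h1 : u ∈ E b <;> by_cases h2 : v ∈ E b <;> simp [h1, h2]
  simp only [Matrix.mulVec, dotProduct]
  rw [Finset.mul_sum, Finset.sum_congr rfl fun v _ => hL v, Finset.sum_comm]
  refine Finset.sum_congr rfl fun b _ => ?_
  by_cases hu : u ∈ E b
  · simp only [if_pos hu, Finset.sum_sub_distrib, Finset.sum_ite_eq', Finset.mem_univ, if_true]
    rw [← h.sum_edge f b]
    exact (if_pos hu).symm
  · simp only [if_neg hu, Finset.sum_const_zero]
    exact (if_neg hu).symm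

end IsRootedBy

/-- The Dirichlet energy (multiplied by `K`) of a function with the value `P b` at the parent and
the values `a (b, s)` at the children of the edge number `b`. -/
def familyEnergy {m K : ℕ} (P : Fin m → ℝ) (a : Fin m × Fin K → ℝ) : ℝ :=
  ∑ b, ((K + 1) * (P b ^ 2 + ∑ s, a (b, s) ^ 2) - (P b + ∑ s, a (b, s)) ^ 2)

open Classical in
theorem IsRootedBy.mul_dotProduct_lapMatrix {V : Type*} [Fintype V] {G : Hypergraph V} {m K : ℕ}
    {r : V} {par : Fin m → V} {ch : Fin m × Fin K → V} (h : G.IsRootedBy r par ch) (hK : K ≠ 0)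
    (f : V → ℝ) :
    K * (f ⬝ᵥ G.lapMatrix.mulVec f) = familyEnergy (f ∘ par) (f ∘ ch) := by
  simp only [dotProduct]
  rw [Finset.mul_sum, Finset.sum_congr rfl fun v _ =>
    show K * (f v * G.lapMatrix.mulVec f v) = f v * (K * G.lapMatrix.mulVec f v) by ring,
    Finset.sum_congr rfl fun v _ => by rw [h.mul_lapMatrix_mulVec hK f v, Finset.mul_sum],
    Finset.sum_comm, familyEnergy]
  refine Finset.sum_congr rfl fun b _ => ?_
  have h1 := h.sum_edge (fun v => f v ^ 2) b
  have h2 := h.sum_edge f b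
  simp only [Function.comp]
  rw [← h1]
  set S := f (par b) + ∑ s, f (ch (b, s)) with hS
  rw [pow_two S, Finset.mul_sum]
  nth_rewrite 2 [← h2]
  rw [Finset.sum_mul, ← Finset.sum_sub_distrib]
  refine Finset.sum_congr rfl fun v _ => ?_
  split_ifs <;> ring

/-! ### Block trees. -/

/-- The position of the child number `s` of the edge number `b`, if the vertices are numbered
block by block. -/
def childIdx {m K : ℕ} (x : Fin m × Fin K) : Fin (m * K + 1) := (finProdFinEquiv x).succ

theorem val_childIdx {m K : ℕ} (b : Fin m) (s : Fin K) :
    (childIdx (b, s) : ℕ) = s + K * b + 1 := rfl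

theorem childIdx_lt {m K : ℕ} {b b' : Fin m} (h : b < b') (s s' : Fin K) :
    childIdx (b, s) < childIdx (b', s') := by
  rw [Fin.lt_def, val_childIdx, val_childIdx]
  have h1 : (b : ℕ) + 1 ≤ b' := h
  have h2 := Nat.mul_le_mul_left K h1
  have h3 := s.2
  rw [Nat.mul_add] at h2
  omega

theorem childIdx_injective {m K : ℕ} :
    Function.Injective (childIdx : Fin m × Fin K → Fin (m * K + 1)) :=
  (Fin.succ_injective _).comp finProdFinEquiv.injective

theorem range_childIdx {m K : ℕ} :
    Set.range (childIdx : Fin m × Fin K → Fin (m * K + 1)) = {0}ᶜ := by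
  ext i
  simp only [Set.mem_range, Set.mem_compl_iff, Set.mem_singleton_iff]
  constructor
  · rintro ⟨x, rfl⟩; exact Fin.succ_ne_zero _
  · intro hi
    obtain ⟨j, rfl⟩ := Fin.exists_succ_eq.mpr hi
    exact ⟨finProdFinEquiv.symm j, by rw [childIdx, Equiv.apply_symm_apply]⟩

/-- The tree whose vertices are numbered by `σ` block by block, such that the parent of the
block number `b` has the number `par b`. -/
def blockTree {V : Type*} {m K : ℕ} (σ : Fin (m * K + 1) ≃ V) (par : Fin m → Fin (m * K + 1)) :
    Hypergraph V where
  vertexSet := Set.univ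
  edgeSet := Set.range fun b => familyEdge (σ (par b)) fun s : Fin K => σ (childIdx (b, s))
  subset_vertexSet_of_mem_edgeSet' _ _ := Set.subset_univ _

section BlockTree

variable {V : Type*} {m K : ℕ} {σ : Fin (m * K + 1) ≃ V} {par : Fin m → Fin (m * K + 1)}

theorem blockTree_isRootedBy (hK : K ≠ 0) (hpar : ∀ b s, par b < childIdx (b, s)) :
    (blockTree σ par).IsRootedBy (σ 0) (σ ∘ par) (σ ∘ childIdx : Fin m × Fin K → V) where
  edgeSet_eq := rfl
  -- If two blocks gave the same edge, a child of each would be the parent of the other, although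
  -- parents precede their children.
  edge_injective := by
    let z : Fin K := ⟨0, Nat.pos_of_ne_zero hK⟩
    have key : ∀ b b', familyEdge (σ (par b)) (fun s : Fin K => σ (childIdx (b, s))) =
        familyEdge (σ (par b')) (fun s : Fin K => σ (childIdx (b', s))) → b ≠ b' →
        childIdx (b, z) = par b' := by
      intro b b' h hb
      have h1 : σ (childIdx (b, z)) ∈ familyEdge (σ (par b)) (fun s => σ (childIdx (b, s))) :=
        .inr ⟨z, rfl⟩
      rw [h] at h1
      rcases h1 with h1 | ⟨s, hs⟩
      · exact σ.injective h1
      · exact absurd (by simpa using (childIdx_injective (σ.injective hs)).symm) (by simp [hb])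
    intro b b' h
    by_contra hb
    have h1 := key b b' h hb
    have h2 := key b' b h.symm (Ne.symm hb)
    have h3 := hpar b z
    have h4 := hpar b' z
    rw [h1] at h3
    rw [h2] at h4
    exact lt_asymm h3 h4
  ch_injective := σ.injective.comp childIdx_injective
  range_ch := by
    rw [Set.range_comp, range_childIdx, Set.image_compl_eq σ.bijective, Set.image_singleton]
  par_ne b s h := (hpar b s).ne (σ.injective h)

theorem blockTree_isConnected (hpar : ∀ b (s : Fin K), par b < childIdx (b, s)) :
    (blockTree σ par).IsConnected := by
  refine ⟨⟨σ 0, trivial⟩, fun x _ y _ => ?_⟩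
  have key : ∀ i, Relation.ReflTransGen (AdjIn (blockTree σ par).edgeSet) (σ 0) (σ i) := by
    intro i
    induction i using WellFoundedLT.induction with
    | ind i ih =>
      by_cases hi : i = 0
      · rw [hi]
      · obtain ⟨⟨b, s⟩, rfl⟩ : i ∈ Set.range (childIdx : Fin m × Fin K → _) := by
          rw [range_childIdx]; exact hi
        exact (ih _ (hpar b s)).tail ⟨_, ⟨b, rfl⟩, .inl rfl, .inr ⟨s, rfl⟩⟩
  have hx := key (σ.symm x)
  have hy := key (σ.symm y)
  rw [Equiv.apply_symm_apply] at hx hy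
  obtain ⟨p, u, e, hp, h0, h1⟩ := exists_isPathIn ((reflTransGen_adjIn_symm hx).trans hy)
  refine ⟨p, fun i => u i, fun i => e i, ⟨fun i => trivial, fun i j hij => ?_, fun i j hij => ?_,
    fun i => hp.edge_mem i i.2, fun i => hp.left_mem i i.2, fun i => hp.right_mem i i.2⟩, h0, h1⟩
  · exact Fin.ext (hp.vertex_inj i (by omega) j (by omega) hij)
  · exact Fin.ext (hp.edge_inj i i.2 j j.2 hij)

/-- Take the edge of a cycle with the largest block number. Only its parent can lie in an earlier
block, but two distinct vertices of it lie in other edges of the cycle. -/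
theorem blockTree_isAcyclic (hpar : ∀ b (s : Fin K), par b < childIdx (b, s)) :
    (blockTree σ par).IsAcyclic := by
  intro p u e hc
  have hp := hc.two_le
  have hblock : ∀ i, ∃ b, familyEdge (σ (par b)) (fun s : Fin K => σ (childIdx (b, s))) = e i :=
    hc.edge_mem
  choose β hβ using hblock
  have hβinj : Function.Injective β := fun i j hij => hc.edge_injective (by
    rw [← hβ i, ← hβ j, hij])
  have : Nonempty (Fin p) := ⟨⟨0, by omega⟩⟩
  obtain ⟨i, hi⟩ := Finite.exists_max β
  -- A vertex of the last block that lies in an earlier block is its parent.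
  have key : ∀ j, j ≠ i → ∀ v, v ∈ e i → v ∈ e j → v = σ (par (β i)) := by
    intro j hj v hvi hvj
    have hlt : β j < β i := lt_of_le_of_ne (hi j) fun h => hj (hβinj h)
    rw [← hβ] at hvi hvj
    rcases hvi with hvi | ⟨s, rfl⟩
    · exact hvi
    · exfalso
      rcases hvj with hvj | ⟨t, ht⟩
      · have h1 := σ.injective hvj
        have h2 := hpar (β j) s
        rw [← h1] at h2
        exact lt_asymm h2 (childIdx_lt hlt _ _)
      · exact (childIdx_lt hlt t s).ne (σ.injective ht)
  have hleft : ∃ j, j ≠ i ∧ u i.castSucc ∈ e j := by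
    by_cases h0 : (i : ℕ) = 0
    · refine ⟨⟨p - 1, by omega⟩, fun h => ?_, ?_⟩
      · have := congrArg Fin.val h; simp at this; omega
      · have h1 := hc.right_mem ⟨p - 1, by omega⟩
        have h2 : (⟨p - 1, by omega⟩ : Fin p).succ = Fin.last p := Fin.ext (by simp; omega)
        have h3 : i.castSucc = 0 := Fin.ext (by simpa using h0)
        rw [h2, hc.closed] at h1
        rwa [h3]
    · refine ⟨⟨i - 1, by omega⟩, fun h => ?_, ?_⟩
      · have := congrArg Fin.val h; simp at this; omega
      · have h1 := hc.right_mem ⟨i - 1, by omega⟩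
        have h2 : (⟨i - 1, by omega⟩ : Fin p).succ = i.castSucc := Fin.ext (by simp; omega)
        rwa [h2] at h1
  have hright : ∃ j, j ≠ i ∧ u i.succ ∈ e j := by
    by_cases h0 : (i : ℕ) + 1 = p
    · refine ⟨⟨0, by omega⟩, fun h => ?_, ?_⟩
      · have := congrArg Fin.val h; simp at this; omega
      · have h1 := hc.left_mem ⟨0, by omega⟩
        have h2 : (⟨0, by omega⟩ : Fin p).castSucc = 0 := rfl
        have h3 : i.succ = Fin.last p := Fin.ext (by simpa using h0)
        rw [h3, hc.closed]
        rwa [h2] at h1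
    · refine ⟨⟨i + 1, by omega⟩, fun h => ?_, ?_⟩
      · have := congrArg Fin.val h; simp at this
      · exact hc.left_mem ⟨i + 1, by omega⟩
  obtain ⟨j, hj, hj'⟩ := hleft
  obtain ⟨l, hl, hl'⟩ := hright
  have h1 := (key j hj _ (hc.left_mem i) hj').trans (key l hl _ (hc.right_mem i) hl').symm
  by_cases h0 : (i : ℕ) + 1 = p
  · have h3 : i.succ = Fin.last p := Fin.ext (by simpa using h0)
    rw [h3, hc.closed] at h1
    have h4 : i = ⟨0, by omega⟩ := hc.vertex_injective h1
    have := congrArg Fin.val h4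
    simp at this
    omega
  · have h4 : i = ⟨i + 1, by omega⟩ := hc.vertex_injective h1
    have := congrArg Fin.val h4
    simp at this

theorem blockTree_isSupertree (hK : K ≠ 0) (hpar : ∀ b s, par b < childIdx (b, s)) :
    (blockTree σ par).IsSupertree (K + 1) where
  vertexSet_eq := rfl
  uniform := (blockTree_isRootedBy hK hpar).isUniform
  connected := blockTree_isConnected hpar
  acyclic := blockTree_isAcyclic hpar

open Classical in
theorem blockTree_degree (hK : K ≠ 0) (hpar : ∀ b (s : Fin K), par b < childIdx (b, s))
    (i : Fin (m * K + 1)) :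
    (blockTree σ par).degree (σ i) =
      (Finset.univ.filter fun b => par b = i).card + if i = 0 then 0 else 1 := by
  rw [(blockTree_isRootedBy hK hpar).degree_eq]
  simp

end BlockTree

/-! ### The variational characterization of the first Dirichlet eigenvalue. -/

section Rayleigh

variable {V : Type*} [Fintype V] (G : Hypergraph V)

-- Eigenvalues of the shifted matrix, shifted back, are Dirichlet eigenvalues. Non-negativity of the
-- form is the Rayleigh bound, and a semidefinite form vanishes only on the kernel, so minimizers
-- are eigenfunctions.
open Classical in
theorem posSemidef_lapMatrix_sub (h : G.interior.Nonempty) :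
    (G.lapMatrix.submatrix (Subtype.val : G.interior → V) Subtype.val -
      G.firstDirichletEigenvalue • (1 : Matrix G.interior G.interior ℝ)).PosSemidef := by
  set M := G.lapMatrix.submatrix (Subtype.val : G.interior → V) Subtype.val with hM
  have hH : (M - G.firstDirichletEigenvalue • (1 : Matrix G.interior G.interior ℝ)).IsHermitian := by
    ext i j
    simp [hM, G.lapMatrix_symm i j, Matrix.one_apply, eq_comm]
  rw [hH.posSemidef_iff_eigenvalues_nonneg]
  intro i
  have h1 := hH.mulVec_eigenvectorBasis i
  have h2 : G.IsDirichletEigenvalue (hH.eigenvalues i + G.firstDirichletEigenvalue) := by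
    rw [isDirichletEigenvalue_iff]
    refine ⟨WithLp.ofLp (hH.eigenvectorBasis i), fun h0 =>
      hH.eigenvectorBasis.orthonormal.ne_zero i (WithLp.ofLp_injective 2 h0), ?_⟩
    rw [Matrix.sub_mulVec, Matrix.smul_mulVec, Matrix.one_mulVec, sub_eq_iff_eq_add] at h1
    rw [add_smul]
    convert h1
  have h3 := (G.isLeast_firstDirichletEigenvalue h).2 h2
  simp only [Pi.zero_apply]
  linarith

open Classical in
theorem sum_interior {F : V → ℝ} (hF : ∀ u ∉ G.interior, F u = 0) :
    ∑ u : G.interior, F u = ∑ u, F u := by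
  rw [← Finset.sum_subset (Finset.subset_univ (Finset.univ.filter (· ∈ G.interior)))
    (fun x _ hx => hF x fun h => hx (Finset.mem_filter.mpr ⟨Finset.mem_univ x, h⟩))]
  exact (Finset.sum_subtype _ (fun x => by simp) _).symm

open Classical in
theorem lapMatrix_submatrix_sub_mulVec {f : V → ℝ} (hf : ∀ u ∉ G.interior, f u = 0) (μ : ℝ)
    (u : G.interior) :
    (G.lapMatrix.submatrix (Subtype.val : G.interior → V) Subtype.val -
      μ • (1 : Matrix G.interior G.interior ℝ)).mulVec (fun v => f v) u =
      G.lapMatrix.mulVec f u - μ * f u := by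
  rw [Matrix.sub_mulVec, Matrix.smul_mulVec, Matrix.one_mulVec]
  simp only [Pi.sub_apply, Pi.smul_apply, smul_eq_mul]
  congr 1
  exact G.sum_interior (F := fun v => G.lapMatrix u v * f v) fun v hv => by simp [hf v hv]

open Classical in
theorem dotProduct_lapMatrix_submatrix_sub {f : V → ℝ} (hf : ∀ u ∉ G.interior, f u = 0) (μ : ℝ) :
    (fun v : G.interior => f v) ⬝ᵥ
      (G.lapMatrix.submatrix (Subtype.val : G.interior → V) Subtype.val -
      μ • (1 : Matrix G.interior G.interior ℝ)).mulVec (fun v => f v) =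
      f ⬝ᵥ G.lapMatrix.mulVec f - μ * ∑ u, f u ^ 2 := by
  classical
  simp only [dotProduct]
  rw [Finset.mul_sum, ← Finset.sum_sub_distrib, ← G.sum_interior fun u hu => by simp [hf u hu]]
  refine Finset.sum_congr rfl fun u _ => ?_
  rw [lapMatrix_submatrix_sub_mulVec G hf]
  ring

/-- The Rayleigh quotient bounds the first Dirichlet eigenvalue. -/
theorem firstDirichletEigenvalue_mul_le (h : G.interior.Nonempty) {f : V → ℝ}
    (hf : ∀ u ∉ G.interior, f u = 0) :
    G.firstDirichletEigenvalue * ∑ u, f u ^ 2 ≤ f ⬝ᵥ G.lapMatrix.mulVec f := by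
  classical
  have h1 := (G.posSemidef_lapMatrix_sub h).dotProduct_mulVec_nonneg (fun v : G.interior => f v)
  simp only [star_trivial] at h1
  have h2 := G.dotProduct_lapMatrix_submatrix_sub hf G.firstDirichletEigenvalue
  linarith [h2.symm.le, h2.le]

/-- A function that minimizes the Rayleigh quotient is an eigenfunction. -/
theorem lapMatrix_mulVec_eq_of_minimizer (h : G.interior.Nonempty) {f : V → ℝ}
    (hf : ∀ u ∉ G.interior, f u = 0)
    (heq : f ⬝ᵥ G.lapMatrix.mulVec f = G.firstDirichletEigenvalue * ∑ u, f u ^ 2) :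
    ∀ u ∈ G.interior, G.lapMatrix.mulVec f u = G.firstDirichletEigenvalue * f u := by
  classical
  intro u hu
  have h1 := (G.posSemidef_lapMatrix_sub h).dotProduct_mulVec_zero_iff (fun v : G.interior => f v)
  simp only [star_trivial] at h1
  have h2 := h1.1 ((G.dotProduct_lapMatrix_submatrix_sub hf _).trans (by rw [heq, sub_self]))
  have h3 := congrFun h2 ⟨u, hu⟩
  rw [G.lapMatrix_submatrix_sub_mulVec hf] at h3
  exact sub_eq_zero.mp h3

theorem exists_minimizer (h : G.interior.Nonempty) :
    ∃ f : V → ℝ, f ≠ 0 ∧ (∀ u ∉ G.interior, f u = 0) ∧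
      f ⬝ᵥ G.lapMatrix.mulVec f = G.firstDirichletEigenvalue * ∑ u, f u ^ 2 := by
  obtain ⟨f, hf⟩ := (G.isLeast_firstDirichletEigenvalue h).1
  have hz : ∀ u ∉ G.interior, f u = 0 := by
    intro u hu
    by_cases hV : u ∈ G.vertexSet
    · exact hf.boundary_eq_zero u (by_contra fun h2 => hu ⟨hV, h2⟩)
    · exact hf.eq_zero_of_notMem u hV
  refine ⟨f, hf.ne_zero, hz, ?_⟩
  rw [Finset.mul_sum]
  refine Finset.sum_congr rfl fun u _ => ?_
  by_cases hu : u ∈ G.interior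
  · rw [hf.eigen u hu]; ring
  · simp [hz u hu]

end Rayleigh

/-! ### Energy under rearrangement. -/

section Energy

variable {m K : ℕ}

/-- With parent values fixed, only the last two sums change when the children are permuted. -/
theorem familyEnergy_eq (P : Fin m → ℝ) (a : Fin m × Fin K → ℝ) :
    familyEnergy P a = K * ∑ b, P b ^ 2 + (K + 1) * ∑ x, a x ^ 2 -
      2 * ∑ x : Fin m × Fin K, P x.1 * a x - ∑ b, (∑ s, a (b, s)) ^ 2 := by
  rw [Fintype.sum_prod_type, Fintype.sum_prod_type]
  simp only [Finset.mul_sum]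
  rw [← Finset.sum_add_distrib, ← Finset.sum_sub_distrib, ← Finset.sum_sub_distrib, familyEnergy]
  refine Finset.sum_congr rfl fun b _ => ?_
  simp only [← Finset.mul_sum]
  ring

/-- Among all ways to group values into blocks, the sum of the squares of the block sums is
largest for the sorted one. -/
theorem sum_sq_block_le {a : Fin m × Fin K → ℝ}
    (ha : ∀ b b', b < b' → ∀ s s', a (b', s') ≤ a (b, s)) (ρ : Equiv.Perm (Fin m × Fin K)) :
    ∑ b, (∑ s, a (ρ (b, s))) ^ 2 ≤ ∑ b, (∑ s, a (b, s)) ^ 2 := by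
  set S : Fin m → ℝ := fun b => ∑ s, a (ρ (b, s)) with hS
  set κ := Tuple.sort (fun b => - S b)
  have hκ : Antitone (S ∘ κ) := fun b b' h => by
    have := Tuple.monotone_sort (fun b => - S b) h
    simpa using this
  -- The weights are the sorted block sums. They are constant on blocks, so the order of `a` inside
  -- a block does not matter.
  have hmono : Monovary (fun x : Fin m × Fin K => S (κ x.1)) a := by
    intro x y hxy
    refine hκ (not_lt.mp fun h => ?_)
    exact absurd (ha _ _ h x.2 y.2) (not_le.mpr hxy)
  have h1 := hmono.sum_mul_comp_perm_le_sum_mul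
    (σ := (κ.prodCongr (Equiv.refl (Fin K))).trans ρ)
  rw [Fintype.sum_prod_type, Fintype.sum_prod_type] at h1
  simp only [← Finset.mul_sum, Equiv.trans_apply, Equiv.prodCongr_apply, Prod.map,
    Equiv.refl_apply] at h1
  have h2 : ∑ b, S (κ b) ^ 2 = ∑ b, S b ^ 2 := Equiv.sum_comp κ fun b => S b ^ 2
  -- With `A` the block sums of `a`, the bounds `∑ S² ≤ ∑ S A` and `∑ (S - A)² ≥ 0` give `∑ S² ≤ ∑
  -- A²`.
  have h3 : 0 ≤ ∑ b, (S (κ b) - ∑ s, a (b, s)) ^ 2 := Finset.sum_nonneg fun b _ => sq_nonneg _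
  have h4 : ∑ b, (S (κ b) - ∑ s, a (b, s)) ^ 2 = ∑ b, S (κ b) ^ 2 -
      2 * ∑ b, S (κ b) * ∑ s, a (b, s) + ∑ b, (∑ s, a (b, s)) ^ 2 := by
    rw [Finset.mul_sum, ← Finset.sum_sub_distrib, ← Finset.sum_add_distrib]
    exact Finset.sum_congr rfl fun b _ => by ring
  have h5 : ∑ b, S (κ b) ^ 2 ≤ ∑ b, S (κ b) * ∑ s, a (b, s) := by
    refine le_trans (le_of_eq ?_) h1
    exact Finset.sum_congr rfl fun b _ => by rw [pow_two]
  linarith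

/-- The energy is smallest if the children are assigned to the parents in sorted order. -/
theorem familyEnergy_le_comp_perm {P : Fin m → ℝ} (hP : Antitone P) {a : Fin m × Fin K → ℝ}
    (ha : ∀ b b', b < b' → ∀ s s', a (b', s') ≤ a (b, s)) (ρ : Equiv.Perm (Fin m × Fin K)) :
    familyEnergy P a ≤ familyEnergy P (a ∘ ρ) := by
  rw [familyEnergy_eq, familyEnergy_eq]
  have h1 := sum_sq_block_le ha ρ
  have h2 : ∑ x, (a ∘ ρ) x ^ 2 = ∑ x, a x ^ 2 := Equiv.sum_comp ρ fun x => a x ^ 2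
  have hmono : Monovary (fun x : Fin m × Fin K => P x.1) a := by
    intro x y hxy
    refine hP (not_lt.mp fun h => ?_)
    exact absurd (ha _ _ h x.2 y.2) (not_le.mpr hxy)
  have h3 := hmono.sum_mul_comp_perm_le_sum_mul (σ := ρ)
  rw [h2]
  simp only [Function.comp]
  linarith

/-- Lowering the values of the parents lowers the energy. -/
theorem familyEnergy_add_le {P P' : Fin m → ℝ} {a : Fin m × Fin K → ℝ} (hP : ∀ b, P' b ≤ P b)
    (ha : ∀ b s, a (b, s) ≤ P' b) :
    familyEnergy P' a + K * ∑ b, (P b - P' b) ^ 2 ≤ familyEnergy P a := by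
  rw [familyEnergy, familyEnergy, Finset.mul_sum, ← Finset.sum_add_distrib]
  refine Finset.sum_le_sum fun b _ => ?_
  have h1 : ∑ s, a (b, s) ≤ K * P' b := by
    refine (Finset.sum_le_sum fun s _ => ha b s).trans ?_
    simp
  -- The two block terms differ by exactly `K (P - P')² + 2 (P - P') (K P' - ∑ a)`.
  nlinarith [mul_nonneg (sub_nonneg.mpr (hP b)) (sub_nonneg.mpr h1)]

/-- The squares are unchanged, while by the triangle inequality the subtracted square of the sum can
only grow. -/
theorem familyEnergy_abs_le (P : Fin m → ℝ) (a : Fin m × Fin K → ℝ) :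
    familyEnergy (fun b => |P b|) (fun x => |a x|) ≤ familyEnergy P a := by
  refine Finset.sum_le_sum fun b _ => ?_
  simp only [sq_abs]
  have h1 : |P b + ∑ s, a (b, s)| ≤ |P b| + ∑ s, |a (b, s)| :=
    (abs_add_le _ _).trans (add_le_add le_rfl (Finset.abs_sum_le_sum_abs _ _))
  have h2 := pow_le_pow_left₀ (abs_nonneg _) h1 2
  rw [sq_abs] at h2
  linarith

end Energy

/-! ### Monotone maps with prescribed fibre sizes. -/

section Counting

theorem exists_monotone_card_fiber {m N : ℕ} (c : Fin N → ℕ) (hc : ∑ i, c i = m) :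
    ∃ q : Fin m → Fin N, Monotone q ∧ ∀ i, (Finset.univ.filter fun b => q b = i).card = c i := by
  have hcard : Fintype.card (Σ i, Fin (c i)) = m := by simp [hc]
  let e : Fin m ≃ Σ i, Fin (c i) := (Fintype.equivFinOfCardEq hcard).symm
  let τ := Tuple.sort fun b => (e b).1
  refine ⟨(fun b => (e b).1) ∘ τ, Tuple.monotone_sort _, fun i => ?_⟩
  rw [← Fintype.card_subtype]
  have e1 : {b // ((fun b => (e b).1) ∘ τ) b = i} ≃ {x : Σ i, Fin (c i) // x.1 = i} :=
    (τ.trans e).subtypeEquiv fun b => Iff.rfl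
  rw [Fintype.card_congr e1, Fintype.card_congr (Equiv.sigmaSubtype i), Fintype.card_fin]

theorem card_filter_le_eq_sum {m N : ℕ} (q : Fin m → Fin N) (i : Fin N) :
    (Finset.univ.filter fun b => q b ≤ i).card =
      ∑ j ∈ Finset.Iic i, (Finset.univ.filter fun b => q b = j).card := by
  rw [Finset.card_eq_sum_card_fiberwise (f := q) (t := Finset.Iic i)]
  · refine Finset.sum_congr rfl fun j hj => ?_
    congr 1
    ext b
    simp only [Finset.mem_filter, Finset.mem_univ, true_and, and_iff_right_iff_imp]
    rintro rfl
    exact Finset.mem_Iic.mp hj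
  · intro b hb
    simpa using hb

/-- For monotone `q` the indices with `q b ≤ i` form an initial segment, so its length decides
membership. This turns partial sums of degrees into positions of parents. -/
theorem le_iff_lt_sum_card {m N : ℕ} {q : Fin m → Fin N} (hq : Monotone q) (b : Fin m)
    (i : Fin N) :
    q b ≤ i ↔ (b : ℕ) < ∑ j ∈ Finset.Iic i, (Finset.univ.filter fun b => q b = j).card := by
  rw [← card_filter_le_eq_sum, ← Tuple.lt_card_le_iff_apply_le_of_monotone hq]

end Counting

/-! ### Eigenfunctions on block trees and the equality case. -/

/-- The vertex number `i` belongs to the block number `b` of the block tree. -/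
def InBlock {m K : ℕ} (par : Fin m → Fin (m * K + 1)) (i : Fin (m * K + 1)) (b : Fin m) : Prop :=
  i = par b ∨ ∃ s : Fin K, i = childIdx (b, s)

open Classical in
/-- The eigenvalue equations of the block tree at the vertices with number less than `n₀`. -/
def IsBlockEigenfunction {m K : ℕ} (n₀ : ℕ) (par : Fin m → Fin (m * K + 1)) (μ : ℝ)
    (g : Fin (m * K + 1) → ℝ) : Prop :=
  ∀ i : Fin (m * K + 1), (i : ℕ) < n₀ → K * (μ * g i) =
    ∑ b, if InBlock par i b then
      ((K + 1) * g i - (g (par b) + ∑ s : Fin K, g (childIdx (b, s)))) else 0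

/-- Stating the equations for positions allows block trees on different vertex sets to be compared.
-/
theorem blockTree_isBlockEigenfunction {V : Type*} [Fintype V] {m K n₀ : ℕ}
    {σ : Fin (m * K + 1) ≃ V} {par : Fin m → Fin (m * K + 1)} (hK : K ≠ 0)
    (hpar : ∀ b (s : Fin K), par b < childIdx (b, s)) {μ : ℝ} {f : V → ℝ}
    (hf : ∀ i : Fin (m * K + 1), (i : ℕ) < n₀ →
      (blockTree σ par).lapMatrix.mulVec f (σ i) = μ * f (σ i)) :
    IsBlockEigenfunction n₀ par μ (f ∘ σ) := by
  classical
  intro i hi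
  have h1 := (blockTree_isRootedBy (σ := σ) hK hpar).mul_lapMatrix_mulVec hK f (σ i)
  rw [hf i hi] at h1
  simp only [Function.comp] at h1 ⊢
  rw [h1]
  refine Finset.sum_congr rfl fun b _ => ?_
  have : (σ i ∈ familyEdge (σ (par b)) fun s : Fin K => σ (childIdx (b, s))) ↔ InBlock par i b := by
    simp [familyEdge, InBlock, eq_comm]
  exact if_congr this rfl rfl

section Eigenfunction

variable {m K n₀ : ℕ} {par : Fin m → Fin (m * K + 1)} {μ : ℝ} {g : Fin (m * K + 1) → ℝ}

/-- Every vertex but the first one is a child. -/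
theorem exists_eq_childIdx {i : Fin (m * K + 1)} (hi : i ≠ 0) :
    ∃ (b : Fin m) (s : Fin K), i = childIdx (b, s) := by
  have : i ∈ Set.range (childIdx : Fin m × Fin K → _) := by rw [range_childIdx]; exact hi
  obtain ⟨⟨b, s⟩, h⟩ := this
  exact ⟨b, s, h.symm⟩

/-- Induction along the numbering: at an interior zero all edge terms are non-positive, and the edge
to the parent, which is positive already, contributes a negative one. -/
theorem IsBlockEigenfunction.pos (h : IsBlockEigenfunction n₀ par μ g)
    (hpar : ∀ b (s : Fin K), par b < childIdx (b, s)) (hg0 : 0 < g 0) (hnn : ∀ i, 0 ≤ g i)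
    (i : Fin (m * K + 1)) (hi : (i : ℕ) < n₀) : 0 < g i := by
  classical
  induction i using WellFoundedLT.induction with
  | ind i ih =>
    by_cases hi0 : i = 0
    · rwa [hi0]
    refine lt_of_le_of_ne (hnn i) fun hz => ?_
    obtain ⟨b, s, hb⟩ := exists_eq_childIdx hi0
    have hlt : par b < i := hb ▸ hpar b s
    have h1 := h i hi
    rw [← hz, mul_zero, mul_zero, mul_zero] at h1
    have hS : ∀ b', 0 ≤ ∑ s : Fin K, g (childIdx (b', s)) := fun b' =>
      Finset.sum_nonneg fun s _ => hnn _
    have h2 : (∑ b, if InBlock par i b then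
        (0 - (g (par b) + ∑ s : Fin K, g (childIdx (b, s)))) else 0) < 0 := by
      refine Finset.sum_neg' (fun b' _ => ?_) ⟨b, Finset.mem_univ _, ?_⟩
      · split_ifs
        · linarith [hS b', hnn (par b')]
        · exact le_rfl
      · rw [if_pos (.inr ⟨s, hb⟩)]
        linarith [hS b, ih (par b) hlt (by omega)]
    exact h2.ne' h1

theorem block_sub_nonneg {par : Fin m → Fin (m * K + 1)} {c : ℝ} (b : Fin m)
    (h1 : g (par b) ≤ c) (h2 : ∀ s : Fin K, g (childIdx (b, s)) ≤ c) :
    0 ≤ (K + 1) * c - (g (par b) + ∑ s : Fin K, g (childIdx (b, s))) := by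
  have : ∑ s : Fin K, g (childIdx (b, s)) ≤ K * c :=
    (Finset.sum_le_sum fun s _ => h2 s).trans (by simp)
  linarith

/-- The first vertex with a value below the maximum `g 0` has a parent with value `g 0`. At this
parent all edge terms are non-negative and one is positive. -/
theorem IsBlockEigenfunction.eigenvalue_pos (h : IsBlockEigenfunction n₀ par μ g)
    (hg : Antitone g) (hpar : ∀ b (s : Fin K), par b < childIdx (b, s)) (hg0 : 0 < g 0)
    (hz : ∀ i : Fin (m * K + 1), n₀ ≤ i → g i = 0) (hn : n₀ < m * K + 1) : 0 < μ := by
  classical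
  have hex : ∃ j : ℕ, ∃ hj : j < m * K + 1, g ⟨j, hj⟩ < g 0 :=
    ⟨n₀, hn, by rw [hz _ le_rfl]; exact hg0⟩
  obtain ⟨hj, hlt⟩ := Nat.find_spec hex
  have hmin : ∀ i : Fin (m * K + 1), (i : ℕ) < Nat.find hex → g i = g 0 := fun i hi =>
    le_antisymm (hg (Fin.zero_le i)) (not_lt.mp fun h => Nat.find_min hex hi ⟨i.2, h⟩)
  generalize Nat.find hex = j at hj hlt hmin
  have hj0 : (⟨j, hj⟩ : Fin (m * K + 1)) ≠ 0 := fun h => by rw [h] at hlt; exact lt_irrefl _ hlt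
  obtain ⟨b, s, hb⟩ := exists_eq_childIdx hj0
  have hpj : par b < ⟨j, hj⟩ := hb ▸ hpar b s
  have hp : g (par b) = g 0 := hmin _ hpj
  have hpn : (par b : ℕ) < n₀ := not_le.mp fun hle => by rw [hz _ hle] at hp; exact hg0.ne hp
  have h1 := h (par b) hpn
  have h2 : 0 < ∑ b', if InBlock par (par b) b' then
      ((K + 1) * g (par b) - (g (par b') + ∑ s : Fin K, g (childIdx (b', s)))) else 0 := by
    rw [hp]
    refine Finset.sum_pos' (fun b' _ => ?_) ⟨b, Finset.mem_univ _, ?_⟩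
    · split_ifs
      · exact block_sub_nonneg b' (hg (Fin.zero_le _)) fun s => hg (Fin.zero_le _)
      · exact le_rfl
    · rw [if_pos (.inl rfl), hp]
      have : ∑ s : Fin K, g (childIdx (b, s)) < ∑ _s : Fin K, g 0 :=
        Finset.sum_lt_sum (fun s _ => hg (Fin.zero_le _)) ⟨s, Finset.mem_univ _, hb ▸ hlt⟩
      simp only [Finset.sum_const, Finset.card_univ, Fintype.card_fin, nsmul_eq_mul] at this
      linarith
  rw [← h1, hp] at h2
  have hK : (0 : ℝ) ≤ K := Nat.cast_nonneg K
  by_contra hμ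
  have : K * (μ * g 0) ≤ 0 :=
    mul_nonpos_of_nonneg_of_nonpos hK (mul_nonpos_of_nonpos_of_nonneg (not_lt.mp hμ) hg0.le)
  linarith

/-- A decreasing function that is zero on the boundary cannot be an eigenfunction for the same
eigenvalue of two different block trees in which the parents have the same values. -/
theorem IsBlockEigenfunction.par_eq {par' : Fin m → Fin (m * K + 1)} (hK : K ≠ 0)
    (h : IsBlockEigenfunction n₀ par μ g) (h' : IsBlockEigenfunction n₀ par' μ g)
    (hg : Antitone g) (hg0 : 0 < g 0) (hz : ∀ i : Fin (m * K + 1), n₀ ≤ i → g i = 0)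
    (hn : n₀ < m * K + 1) (hpar : ∀ b (s : Fin K), par b < childIdx (b, s))
    (hpar' : ∀ b (s : Fin K), par' b < childIdx (b, s)) (hint : ∀ b, (par b : ℕ) < n₀)
    (hmono' : Monotone par') (hle : ∀ b, par b ≤ par' b) (hP : ∀ b, g (par b) = g (par' b)) :
    par = par' := by
  classical
  by_contra hne
  have hnn : ∀ i, 0 ≤ g i := fun i => by
    have h1 : g ⟨m * K, by omega⟩ = 0 := hz _ (by simp only; omega)
    rw [← h1]
    exact hg (Fin.le_def.mpr (by simp only; omega))
  -- Both equations are considered at `par b`, where `b` is the first block whose parents differ.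
  obtain ⟨b, hb, hmin⟩ : ∃ b, par b ≠ par' b ∧ ∀ b' < b, par b' = par' b' := by
    obtain ⟨b, hb, hmin⟩ := WellFounded.has_min (wellFounded_lt (α := Fin m)) {b | par b ≠ par' b}
      (Function.ne_iff.mp hne)
    exact ⟨b, hb, fun b' hb' => not_not.mp fun h => hmin b' h hb'⟩
  have hlt : par b < par' b := lt_of_le_of_ne (hle b) hb
  have hfib : ∀ b', par' b' = par b → b' < b := fun b' hb' => not_le.mp fun hle' =>
    (hlt.trans_le (hmono' hle')).ne' hb'
  -- As `par'` is monotone and already past `par b` at `b`, this vertex only loses edges in the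
  -- second tree.
  have hsub : ∀ b', InBlock par' (par b) b' → InBlock par (par b) b' := by
    rintro b' (h1 | h1)
    · exact .inl (h1.trans (hmin b' (hfib b' h1.symm)).symm)
    · exact .inr h1
  have e1 := h (par b) (hint b)
  have e2 := h' (par b) (hint b)
  set t := g (par b) with ht
  have hmemb : InBlock par (par b) b ∧ ¬ InBlock par' (par b) b := by
    refine ⟨.inl rfl, ?_⟩
    rintro (h1 | ⟨s, hs⟩)
    · exact hb h1
    · exact (hpar b s).ne hs
  -- Common blocks cancel, since their parents have equal values. The lost blocks have `par b` as
  -- parent, hence non-negative terms, which must all vanish.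
  have hdiff : ∑ b', (if InBlock par (par b) b' ∧ ¬ InBlock par' (par b) b' then
      ((K + 1) * t - (g (par b') + ∑ s : Fin K, g (childIdx (b', s)))) else 0) = 0 := by
    have e3 := e1.symm.trans e2
    rw [← sub_eq_zero, ← Finset.sum_sub_distrib] at e3
    refine Eq.trans (Finset.sum_congr rfl fun b' _ => ?_) e3
    by_cases m2 : InBlock par' (par b) b'
    · have m1 := hsub b' m2
      simp [m1, m2, hP b']
    · by_cases m1 : InBlock par (par b) b' <;> simp [m1, m2]
  have hterm : ∀ b' ∈ Finset.univ, 0 ≤ (if InBlock par (par b) b' ∧ ¬ InBlock par' (par b) b' then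
      ((K + 1) * t - (g (par b') + ∑ s : Fin K, g (childIdx (b', s)))) else 0) := by
    intro b' _
    split_ifs with hm
    · obtain ⟨h1 | h1, h2⟩ := hm
      · refine block_sub_nonneg b' (by rw [← h1]) fun s => hg ?_
        rw [h1]; exact (hpar b' s).le
      · exact absurd (.inr h1) h2
    · exact le_rfl
  have hb0 := (Finset.sum_eq_zero_iff_of_nonneg hterm).mp hdiff b (Finset.mem_univ b)
  rw [if_pos hmemb] at hb0
  have hchild : ∀ s : Fin K, g (childIdx (b, s)) = t := by
    have h1 : ∑ s : Fin K, (t - g (childIdx (b, s))) = 0 := by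
      rw [Finset.sum_sub_distrib]
      simp only [Finset.sum_const, Finset.card_univ, Fintype.card_fin, nsmul_eq_mul]
      linarith
    intro s
    have h2 := (Finset.sum_eq_zero_iff_of_nonneg fun s _ =>
      sub_nonneg.mpr (hg (hpar b s).le)).mp h1 s (Finset.mem_univ s)
    linarith
  let z : Fin K := ⟨0, Nat.pos_of_ne_zero hK⟩
  -- The remaining blocks at `par b` precede block `b`, whose children all have the value `t`, so
  -- their values are at least `t`.
  have hle0 : K * (μ * t) ≤ 0 := by
    rw [e2]
    refine Finset.sum_nonpos fun b' _ => ?_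
    split_ifs with hm
    · have hb' : b' < b := by
        rcases hm with h1 | ⟨s, hs⟩
        · exact hfib b' h1.symm
        · rcases lt_trichotomy b' b with h2 | h2 | h2
          · exact h2
          · subst h2
            exact absurd hs (hpar b' s).ne
          · exact absurd (hs ▸ (hpar b z).trans (childIdx_lt h2 z s)) (lt_irrefl _)
      have hc : ∀ s : Fin K, t ≤ g (childIdx (b', s)) := fun s => by
        rw [← hchild z]; exact hg (childIdx_lt hb' s z).le
      have hp : t ≤ g (par' b') := (hc z).trans (hg (hpar' b' z).le)
      have hs : K * t ≤ ∑ s : Fin K, g (childIdx (b', s)) :=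
        le_trans (by simp) (Finset.sum_le_sum fun s _ => hc s)
      linarith
    · exact le_rfl
  have hμ := h.eigenvalue_pos hg hpar hg0 hz hn
  have htpos : 0 < t := h.pos hpar hg0 hnn (par b) (hint b)
  have : (0 : ℝ) < K := by exact_mod_cast Nat.pos_of_ne_zero hK
  exact absurd hle0 (not_le.mpr (by positivity))

end Eigenfunction

/-! ### Degree sequences and the block tree they define. -/

/-- The numerical properties of the degree sequence of a supertree with `m` edges of size
`K + 1`. -/
structure IsTreeSequence (m K n₀ : ℕ) (d : Fin (m * K + 1) → ℕ) : Prop where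
  two_le : ∀ i : Fin (m * K + 1), (i : ℕ) < n₀ → 2 ≤ d i
  eq_one : ∀ i : Fin (m * K + 1), n₀ ≤ i → d i = 1
  sum_eq : ∑ i, d i = m * (K + 1)

/-- The number of edges in which a vertex of given degree is the parent. -/
def childCount {N : ℕ} (d : Fin (N + 1) → ℕ) (i : Fin (N + 1)) : ℕ := if i = 0 then d i else d i - 1

/-- Each of the `i` non-root positions up to `i` spends one degree on the edge in which it is a
child. -/
theorem sum_Iic_childCount {N : ℕ} {d : Fin (N + 1) → ℕ} (hd : ∀ i, 1 ≤ d i) (i : Fin (N + 1)) :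
    ∑ j ∈ Finset.Iic i, childCount d j + i = ∑ j ∈ Finset.Iic i, d j := by
  have h1 : ∑ j ∈ Finset.Iic i, d j =
      ∑ j ∈ Finset.Iic i, (childCount d j + if j = 0 then 0 else 1) := by
    refine Finset.sum_congr rfl fun j _ => ?_
    have := hd j
    rw [childCount]
    split_ifs <;> omega
  have h2 : ∑ j ∈ Finset.Iic i, (if j = 0 then 0 else 1) = (i : ℕ) := by
    have h3 := Finset.card_erase_of_mem (Finset.mem_Iic.mpr (Fin.zero_le i))
    rw [Fin.card_Iic, Nat.add_sub_cancel, ← Finset.filter_ne'] at h3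
    rw [← h3, Finset.card_filter]
    exact Finset.sum_congr rfl fun j _ => by by_cases h : j = 0 <;> simp [h]
  rw [h1, Finset.sum_add_distrib, h2]

namespace IsTreeSequence

variable {m K n₀ : ℕ} {d : Fin (m * K + 1) → ℕ}

theorem one_le (h : IsTreeSequence m K n₀ d) (i : Fin (m * K + 1)) : 1 ≤ d i := by
  rcases lt_or_ge (i : ℕ) n₀ with hi | hi
  · exact (h.two_le i hi).trans' one_le_two
  · exact (h.eq_one i hi).ge

theorem sum_childCount (h : IsTreeSequence m K n₀ d) : ∑ i, childCount d i = m := by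
  have h1 := sum_Iic_childCount h.one_le (Fin.last _)
  have h2 : Finset.Iic (Fin.last (m * K)) = Finset.univ := by
    ext i; simp [Fin.le_last]
  rw [h2, h.sum_eq, Fin.val_last, Nat.mul_succ] at h1
  omega

/-- There is a vertex of degree one. -/
theorem lt_card (h : IsTreeSequence m K n₀ d) (hK : K ≠ 0) : n₀ < m * K + 1 := by
  by_contra hn
  have h1 : ∑ i : Fin (m * K + 1), 2 ≤ ∑ i, d i :=
    Finset.sum_le_sum fun i _ => h.two_le i (by omega)
  rw [h.sum_eq] at h1
  simp only [Finset.sum_const, Finset.card_univ, Fintype.card_fin, smul_eq_mul] at h1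
  have h2 : m * 1 ≤ m * K := Nat.mul_le_mul_left m (by omega)
  rw [Nat.mul_succ m K] at h1
  omega

/-- The numbers of the parents in the sorted block tree. -/
theorem exists_par (h : IsTreeSequence m K n₀ d) : ∃ par : Fin m → Fin (m * K + 1), Monotone par ∧
    ∀ i, (Finset.univ.filter fun b => par b = i).card = childCount d i :=
  exists_monotone_card_fiber _ h.sum_childCount

variable {par : Fin m → Fin (m * K + 1)}

theorem par_lt_interior (h : IsTreeSequence m K n₀ d) (hn₀ : 0 < n₀)
    (hc : ∀ i, (Finset.univ.filter fun b => par b = i).card = childCount d i) (b : Fin m) :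
    (par b : ℕ) < n₀ := by
  by_contra hi
  have h1 : 0 < (Finset.univ.filter fun b' => par b' = par b).card :=
    Finset.card_pos.mpr ⟨b, by simp⟩
  rw [hc, childCount, if_neg, h.eq_one _ (not_lt.mp hi)] at h1
  · exact lt_irrefl _ h1
  · intro h0; rw [h0] at hi; exact hi hn₀

/-- For a parent number `p ≥ 1`, the `p` earlier vertices have degree at least two and are parents
of at least `2 p - (p - 1) = p + 1` blocks. Hence `b > p`, while children of block `b` have numbers
above `b`. -/
theorem par_lt_childIdx (h : IsTreeSequence m K n₀ d) (hn₀ : 0 < n₀) (hmono : Monotone par)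
    (hc : ∀ i, (Finset.univ.filter fun b => par b = i).card = childCount d i) (b : Fin m)
    (s : Fin K) : par b < childIdx (b, s) := by
  rw [Fin.lt_def, val_childIdx]
  have hint := h.par_lt_interior hn₀ hc b
  by_cases h0 : (par b : ℕ) = 0
  · omega
  let j : Fin (m * K + 1) := ⟨par b - 1, by omega⟩
  have h1 : ¬ par b ≤ j := by
    rw [Fin.le_def]; simp only [j]; omega
  rw [le_iff_lt_sum_card hmono, not_lt] at h1
  simp only [hc] at h1
  have h2 := sum_Iic_childCount h.one_le j
  have h3 : ∑ i ∈ Finset.Iic j, 2 ≤ ∑ i ∈ Finset.Iic j, d i := Finset.sum_le_sum fun i hi =>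
    h.two_le i (by have := Fin.le_def.mp (Finset.mem_Iic.mp hi); simp only [j] at this; omega)
  rw [Finset.sum_const, Fin.card_Iic, smul_eq_mul] at h3
  have h4 : (j : ℕ) = par b - 1 := rfl
  have h5 : 1 * (b : ℕ) ≤ K * b := Nat.mul_le_mul_right _ (by have := s.2; omega)
  omega

/-- The degrees of the block tree. -/
theorem blockTree_degree {V : Type*} {σ : Fin (m * K + 1) ≃ V} (h : IsTreeSequence m K n₀ d)
    (hK : K ≠ 0) (hn₀ : 0 < n₀) (hmono : Monotone par)
    (hc : ∀ i, (Finset.univ.filter fun b => par b = i).card = childCount d i)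
    (i : Fin (m * K + 1)) : (blockTree σ par).degree (σ i) = d i := by
  classical
  rw [Hypergraph.blockTree_degree hK (h.par_lt_childIdx hn₀ hmono hc)]
  have h1 := hc i
  have h2 := h.one_le i
  simp only [childCount] at h1
  convert_to (Finset.univ.filter fun b => par b = i).card + _ = _
  rw [h1]
  split_ifs <;> omega

theorem mem_interior_iff {V : Type*} {σ : Fin (m * K + 1) ≃ V} (h : IsTreeSequence m K n₀ d)
    (hK : K ≠ 0) (hn₀ : 0 < n₀) (hmono : Monotone par)
    (hc : ∀ i, (Finset.univ.filter fun b => par b = i).card = childCount d i)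
    (i : Fin (m * K + 1)) : (i : ℕ) < n₀ ↔ σ i ∈ (blockTree σ par).interior := by
  have h1 := h.blockTree_degree (σ := σ) hK hn₀ hmono hc i
  have h2 : σ i ∈ (blockTree σ par).interior ↔ d i ≠ 1 := by
    rw [← h1]
    exact ⟨fun hi hd => hi.2 ⟨trivial, hd⟩, fun hd => ⟨trivial, fun hi => hd hi.2⟩⟩
  rw [h2]
  constructor
  · intro hi
    have := h.two_le i hi
    omega
  · intro hd
    by_contra hi
    exact hd (h.eq_one i (not_lt.mp hi))

theorem blockTree_mem {V : Type*} {σ : Fin (m * K + 1) ≃ V} (h : IsTreeSequence m K n₀ d)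
    (hK : K ≠ 0) (hn₀ : 0 < n₀) (hmono : Monotone par)
    (hc : ∀ i, (Finset.univ.filter fun b => par b = i).card = childCount d i)
    (hsort : ∀ i j : Fin (m * K + 1), i ≤ j → (j : ℕ) < n₀ → d i ≤ d j) :
    blockTree σ par ∈ supertreesOfDegreeSequence V (K + 1) n₀ d :=
  ⟨blockTree_isSupertree hK (h.par_lt_childIdx hn₀ hmono hc), σ,
    h.blockTree_degree hK hn₀ hmono hc, h.mem_interior_iff hK hn₀ hmono hc, hsort⟩

end IsTreeSequence

/-! ### Sorting the vertices of a supertree. -/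

/-- A sequence that is sorted on the first `n₀` places and one elsewhere has the smallest partial
sums among its rearrangements. -/
theorem sum_Iic_le_sum_Iic_perm {N n₀ : ℕ} {d : Fin N → ℕ} (e : Equiv.Perm (Fin N))
    (he : ∀ i, (e i : ℕ) < n₀ ↔ (i : ℕ) < n₀) (hd : ∀ i : Fin N, n₀ ≤ i → d i = 1)
    (hsort : ∀ i j : Fin N, i ≤ j → (j : ℕ) < n₀ → d i ≤ d j) (i : Fin N) :
    ∑ j ∈ Finset.Iic i, d j ≤ ∑ j ∈ Finset.Iic i, d (e j) := by
  have hmap : ∑ j ∈ Finset.Iic i, d (e j) = ∑ j ∈ (Finset.Iic i).map e.toEmbedding, d j :=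
    (Finset.sum_map (Finset.Iic i) e.toEmbedding d).symm
  rw [hmap, ← Finset.sum_sdiff_le_sum_sdiff]
  -- Common places cancelled, the two differences have equal size and the value `d i` separates
  -- them.
  have hcard : (Finset.Iic i \ (Finset.Iic i).map e.toEmbedding).card =
      ((Finset.Iic i).map e.toEmbedding \ Finset.Iic i).card :=
    Finset.card_sdiff_comm (by simp)
  calc _ ≤ (Finset.Iic i \ (Finset.Iic i).map e.toEmbedding).card • d i := by
        refine Finset.sum_le_card_nsmul _ _ _ fun x hx => ?_
        obtain ⟨hx1, hx2⟩ := Finset.mem_sdiff.mp hx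
        rcases lt_or_ge (i : ℕ) n₀ with hi | hi
        · exact hsort x i (Finset.mem_Iic.mp hx1) hi
        · rw [hd i hi, hd x]
          by_contra hxn
          refine hx2 (Finset.mem_map.mpr ⟨e.symm x, Finset.mem_Iic.mpr ?_, by simp⟩)
          have := (he (e.symm x)).mp (by simpa using hxn)
          rw [Fin.le_def]
          omega
    _ = ((Finset.Iic i).map e.toEmbedding \ Finset.Iic i).card • d i := by rw [hcard]
    _ ≤ _ := by
        refine Finset.card_nsmul_le_sum _ _ _ fun y hy => ?_
        obtain ⟨hy1, hy2⟩ := Finset.mem_sdiff.mp hy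
        obtain ⟨j, hj, rfl⟩ := Finset.mem_map.mp hy1
        have hji := Fin.le_def.mp (Finset.mem_Iic.mp hj)
        have hij : i < e j := not_le.mp fun h => hy2 (Finset.mem_Iic.mpr h)
        rcases lt_or_ge (i : ℕ) n₀ with hi | hi
        · exact hsort _ _ hij.le ((he j).mpr (by omega))
        · rw [hd i hi]
          refine (hd _ ?_).ge
          have := Fin.lt_def.mp hij
          simp only [Equiv.toEmbedding_apply]
          omega

/-- The vertices can be numbered by decreasing values, interior vertices first. -/
theorem exists_sorted_equiv {V : Type*} {N n₀ : ℕ} (σ₀ : Fin N ≃ V) {S : Set V}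
    (hS : ∀ i : Fin N, (i : ℕ) < n₀ ↔ σ₀ i ∈ S) {f : V → ℝ} (hf : ∀ v, 0 ≤ f v)
    (hf0 : ∀ v ∉ S, f v = 0) :
    ∃ σ : Fin N ≃ V, (∀ i : Fin N, (i : ℕ) < n₀ ↔ σ i ∈ S) ∧ Antitone (f ∘ σ) := by
  classical
  let κ : Fin N → ℕ := fun i => if σ₀ i ∈ S then 0 else 1
  -- Interior vertices first, then decreasing values; the order persists across the border because
  -- `f` vanishes outside `S`.
  let key : Fin N → ℕ ×ₗ ℝ := fun i => toLex (κ i, - f (σ₀ i))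
  let τ := Tuple.sort key
  have hkey : Monotone (key ∘ τ) := Tuple.monotone_sort key
  have h1 : Monotone (κ ∘ τ) := fun i j hij => (Prod.Lex.toLex_le_toLex'.mp (hkey hij)).1
  have h2 : Monotone (κ ∘ Equiv.refl (Fin N)) := by
    intro i j hij
    have := Fin.le_def.mp hij
    simp only [κ, Function.comp, Equiv.refl_apply]
    split_ifs with hi hj hj
    · exact le_rfl
    · exact zero_le_one
    · exact absurd ((hS i).mp (by have := (hS j).mpr hj; omega)) hi
    · exact le_rfl
  -- The flags were sorted from the start and a sorted rearrangement is unique, so the first `n₀`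
  -- places still belong to `S`.
  have h3 : ∀ i, κ (τ i) = κ i := fun i => congrFun (Tuple.unique_monotone h1 h2) i
  have h4 : ∀ i, σ₀ (τ i) ∈ S ↔ σ₀ i ∈ S := fun i => by
    have := h3 i
    simp only [κ] at this
    by_cases ha : σ₀ (τ i) ∈ S <;> by_cases hb : σ₀ i ∈ S <;> simp_all
  refine ⟨τ.trans σ₀, fun i => ?_, fun i j hij => ?_⟩
  · rw [Equiv.trans_apply, h4, hS]
  · have h5 := Prod.Lex.toLex_le_toLex.mp (hkey hij)
    simp only [Function.comp, Equiv.trans_apply]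
    rcases h5 with h5 | h5
    · have hj : σ₀ (τ j) ∉ S := fun hj => by
        simp only [κ, if_pos hj] at h5
        exact Nat.not_lt_zero _ h5
      rw [hf0 _ hj]
      exact hf _
    · exact neg_le_neg_iff.mp h5.2

/-- The sum of the degrees, and the bound for the degrees of a supertree with an edge. -/
theorem IsSupertree.isTreeSequence {V : Type*} [Fintype V] {G : Hypergraph V} {m K n₀ : ℕ}
    (hG : G.IsSupertree (K + 1)) (hmK : m * K ≠ 0) {d : Fin (m * K + 1) → ℕ}
    (σ : Fin (m * K + 1) ≃ V) (hd : ∀ i, G.degree (σ i) = d i)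
    (hint : ∀ i : Fin (m * K + 1), (i : ℕ) < n₀ ↔ σ i ∈ G.interior) :
    IsTreeSequence m K n₀ d := by
  classical
  have hcard : Fintype.card V = m * K + 1 := by
    rw [← Fintype.card_congr σ, Fintype.card_fin]
  have hroot : ∀ r, ∃ (par : Fin m → V) (ch : Fin m × Fin K → V), G.IsRootedBy r par ch := by
    intro r
    obtain ⟨m', par, ch, h⟩ := hG.exists_isRootedBy r
    have h1 := h.card_eq
    rw [hcard] at h1
    have h2 : m' = m := (Nat.eq_of_mul_eq_mul_right
      (Nat.pos_of_ne_zero (right_ne_zero_of_mul hmK)) (by omega)).symm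
    subst h2
    exact ⟨par, ch, h⟩
  have hmem : ∀ v, v ∈ G.interior ↔ G.degree v ≠ 1 := fun v => by
    have hv : v ∈ G.vertexSet := by rw [hG.vertexSet_eq]; trivial
    exact ⟨fun hi h => hi.2 ⟨hv, h⟩, fun h => ⟨hv, fun hi => h hi.2⟩⟩
  refine ⟨fun i hi => ?_, fun i hi => ?_, ?_⟩
  · have : Nontrivial V := Fintype.one_lt_card_iff_nontrivial.mp (by omega)
    -- Rooted elsewhere, the vertex is a child, so its degree is positive; being interior, it is not
    -- one.
    obtain ⟨r, hr⟩ := exists_ne (σ i)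
    obtain ⟨par, ch, h⟩ := hroot r
    have h1 := h.degree_eq (σ i)
    rw [if_neg hr.symm] at h1
    have h2 := (hmem _).mp ((hint i).mp hi)
    rw [← hd]
    omega
  · rw [← hd]
    by_contra h1
    have := (hint i).mpr ((hmem _).mpr h1)
    omega
  · obtain ⟨par, ch, h⟩ := hroot (σ 0)
    rw [← Finset.sum_congr rfl fun i _ => hd i, Equiv.sum_comp σ G.degree,
      Finset.sum_congr rfl fun v _ => h.degree_eq v, Finset.sum_add_distrib]
    have h1 := Finset.card_eq_sum_card_fiberwise (f := par) (s := Finset.univ) (t := Finset.univ)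
      (fun _ _ => Finset.mem_univ _)
    rw [Finset.card_univ, Fintype.card_fin] at h1
    have h2 : ∑ v, (if v = σ 0 then 0 else 1) = m * K := by
      have h3 := Finset.card_erase_of_mem (Finset.mem_univ (σ 0))
      rw [Finset.card_univ, hcard, Nat.add_sub_cancel, ← Finset.filter_ne'] at h3
      refine Eq.trans ?_ h3
      rw [Finset.card_filter]
      exact Finset.sum_congr rfl fun j _ => by by_cases h : j = σ 0 <;> simp [h]
    rw [h2, Nat.mul_succ, Nat.add_comm]
    congr 1
    convert h1.symm

theorem IsSupertree.degree_eq_one {V : Type*} {G : Hypergraph V} {k : ℕ} (hG : G.IsSupertree k)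
    {v : V} (hv : v ∉ G.interior) : G.degree v = 1 := by
  by_contra h
  exact hv ⟨by rw [hG.vertexSet_eq]; trivial, fun hb => h hb.2⟩

/-- Smaller partial sums of the degrees give larger numbers of the parents. -/
theorem le_of_forall_sum_Iic_le {m K : ℕ} {d d' : Fin (m * K + 1) → ℕ}
    {q q' : Fin m → Fin (m * K + 1)} (hd : ∀ i, 1 ≤ d i) (hd' : ∀ i, 1 ≤ d' i)
    (hq : Monotone q) (hq' : Monotone q')
    (hc : ∀ i, (Finset.univ.filter fun b => q b = i).card = childCount d i)
    (hc' : ∀ i, (Finset.univ.filter fun b => q' b = i).card = childCount d' i)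
    (hle : ∀ i, ∑ j ∈ Finset.Iic i, d' j ≤ ∑ j ∈ Finset.Iic i, d j) (b : Fin m) :
    q b ≤ q' b := by
  have h1 := (le_iff_lt_sum_card hq' b (q' b)).mp le_rfl
  rw [le_iff_lt_sum_card hq]
  simp only [hc, hc'] at h1 ⊢
  have h2 := sum_Iic_childCount hd (q' b)
  have h3 := sum_Iic_childCount hd' (q' b)
  have h4 := hle (q' b)
  omega

/-! ### Rearrangement into a block tree, and the comparison. -/

/-- Rearranging a function on a supertree into a block tree does not raise its energy. -/
theorem IsSupertree.exists_energy_le {V : Type*} [Fintype V] {G : Hypergraph V} {m K n₀ : ℕ}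
    (hG : G.IsSupertree (K + 1)) (hK : K ≠ 0) {d : Fin (m * K + 1) → ℕ}
    (hd : IsTreeSequence m K n₀ d) (hn₀ : 0 < n₀)
    (hsort : ∀ i j : Fin (m * K + 1), i ≤ j → (j : ℕ) < n₀ → d i ≤ d j)
    {σ₀ σ : Fin (m * K + 1) ≃ V} (hσ₀ : ∀ i, G.degree (σ₀ i) = d i)
    (hint₀ : ∀ i : Fin (m * K + 1), (i : ℕ) < n₀ ↔ σ₀ i ∈ G.interior)
    (hint : ∀ i : Fin (m * K + 1), (i : ℕ) < n₀ ↔ σ i ∈ G.interior)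
    {f : V → ℝ} (hf : Antitone (f ∘ σ)) {par : Fin m → Fin (m * K + 1)} (hmono : Monotone par)
    (hc : ∀ i, (Finset.univ.filter fun b => par b = i).card = childCount d i) :
    familyEnergy (f ∘ σ ∘ par) (f ∘ σ ∘ (childIdx : Fin m × Fin K → _)) ≤
      K * (f ⬝ᵥ G.lapMatrix.mulVec f) := by
  classical
  have hpar := hd.par_lt_childIdx hn₀ hmono hc
  obtain ⟨m', par₁, ch₁, h₁⟩ := hG.exists_isRootedBy (σ 0)
  have hm : m' = m := by
    have h1 := h₁.card_eq
    rw [← Fintype.card_congr σ, Fintype.card_fin] at h1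
    exact (Nat.eq_of_mul_eq_mul_right (Nat.pos_of_ne_zero hK) (by omega)).symm
  subst hm
  let τ := Tuple.sort fun b => σ.symm (par₁ b)
  have h₂ := h₁.comp_perm τ
  set q : Fin m' → Fin (m' * K + 1) := (fun b => σ.symm (par₁ b)) ∘ τ with hqdef
  have hq : Monotone q := Tuple.monotone_sort _
  have hparq : par₁ ∘ τ = σ ∘ q := by funext b; simp [q]
  have hT := blockTree_isRootedBy (σ := σ) hK hpar
  -- Both trees are rooted at `σ 0`, so their children are the same vertices up to a permutation.
  let ρ : Equiv.Perm (Fin m' × Fin K) := h₂.chEquiv.trans hT.chEquiv.symm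
  have hρ : (fun x : Fin m' × Fin K => ch₁ (τ x.1, x.2)) = σ ∘ childIdx ∘ ρ := by
    funext x
    have h1 := hT.chEquiv_apply (ρ x)
    have h2 := h₂.chEquiv_apply x
    rw [← h2]
    simp only [Function.comp] at h1 ⊢
    rw [← h1]
    simp [ρ]
  rw [h₂.mul_dotProduct_lapMatrix hK, hparq, hρ]
  -- `q` uses the degrees of `G` in the order of decreasing `f`; the sorted sequence `d` has the
  -- smallest partial sums and so the latest parents.
  have hle : ∀ b, q b ≤ par b := by
    refine le_of_forall_sum_Iic_le (d := fun i => G.degree (σ i)) (d' := d) ?_ hd.one_le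
      hq hmono ?_ hc ?_
    · intro i
      have := hd.one_le (σ₀.symm (σ i))
      rwa [← hσ₀, Equiv.apply_symm_apply] at this
    · intro i
      have h1 := h₂.degree_eq (σ i)
      rw [hparq] at h1
      simp only [Function.comp, EmbeddingLike.apply_eq_iff_eq] at h1
      rw [childCount, h1]
      have h2 : (Finset.univ.filter fun b => q b = i).card =
        (@Finset.filter _ (fun b => q b = i) (fun b => Classical.propDecidable _)
          Finset.univ).card := by congr!
      rw [h2]
      split_ifs <;> omega
    · intro i
      have h1 := sum_Iic_le_sum_Iic_perm (σ.trans σ₀.symm) (fun i => ?_) hd.eq_one hsort i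
      · refine h1.trans (Finset.sum_le_sum fun j _ => ?_)
        rw [← hσ₀]; simp
      · rw [hint₀, hint]; simp
  have ha : ∀ b b' : Fin m', b < b' → ∀ s s' : Fin K,
      (f ∘ σ ∘ childIdx) (b', s') ≤ (f ∘ σ ∘ childIdx) (b, s) :=
    fun b b' hb s s' => hf (childIdx_lt hb s s').le
  have hP : Antitone (f ∘ σ ∘ q) := fun b b' hb => hf (hq hb)
  have e1 := familyEnergy_le_comp_perm hP ha ρ
  have e2 := familyEnergy_add_le (P := f ∘ σ ∘ q) (P' := f ∘ σ ∘ par)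
    (a := f ∘ σ ∘ (childIdx : Fin m' × Fin K → _)) (fun b => hf (hle b))
    (fun b s => hf (hpar b s).le)
  have e3 : (0 : ℝ) ≤ K * ∑ b, ((f ∘ σ ∘ q) b - (f ∘ σ ∘ par) b) ^ 2 :=
    mul_nonneg (Nat.cast_nonneg K) (Finset.sum_nonneg fun b _ => sq_nonneg _)
  exact ((le_add_of_nonneg_right e3).trans e2).trans e1

/-- There is a non-negative function that minimizes the Rayleigh quotient. -/
theorem exists_nonneg_minimizer_energy {V : Type*} [Fintype V] {G : Hypergraph V} {K : ℕ}
    (hG : G.IsSupertree (K + 1)) (hK : K ≠ 0) (h : G.interior.Nonempty) :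
    ∃ f : V → ℝ, (∀ u, 0 ≤ f u) ∧ f ≠ 0 ∧ (∀ u ∉ G.interior, f u = 0) ∧
      f ⬝ᵥ G.lapMatrix.mulVec f ≤ G.firstDirichletEigenvalue * ∑ u, f u ^ 2 := by
  obtain ⟨f, hf0, hfz, hf⟩ := G.exists_minimizer h
  refine ⟨fun u => |f u|, fun u => abs_nonneg _, fun h0 => hf0 ?_, fun u hu => by simp [hfz u hu],
    ?_⟩
  · funext u
    exact abs_eq_zero.mp (congrFun h0 u)
  · simp only [sq_abs]
    rw [← hf]
    obtain ⟨r, -⟩ := h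
    obtain ⟨m, par, ch, h₁⟩ := hG.exists_isRootedBy r
    have hK' : (0 : ℝ) < K := by exact_mod_cast Nat.pos_of_ne_zero hK
    refine le_of_mul_le_mul_left ?_ hK'
    rw [h₁.mul_dotProduct_lapMatrix hK, h₁.mul_dotProduct_lapMatrix hK]
    exact familyEnergy_abs_le _ _

/-- The comparison for sequences of a given number of edges. -/
theorem firstDirichletEigenvalue_lt_of_isMajorizedBy {V V' : Type*} [Fintype V] [Fintype V']
    {m K n₀ : ℕ} (hK : K ≠ 0) (hm : m ≠ 0) (hn₀ : 0 < n₀) {π π' : Fin (m * K + 1) → ℕ}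
    {G : Hypergraph V} {G' : Hypergraph V'}
    (hG : G.HasFaberKrahnProperty (supertreesOfDegreeSequence V (K + 1) n₀ π))
    (hG' : G'.HasFaberKrahnProperty (supertreesOfDegreeSequence V' (K + 1) n₀ π'))
    (hmaj : IsMajorizedBy π' π) (hne : π ≠ π') :
    G'.firstDirichletEigenvalue < G.firstDirichletEigenvalue := by
  classical
  obtain ⟨⟨hGt, σ₀, hσ₀, hint₀, hsort⟩, hGmin⟩ := hG
  obtain ⟨⟨hGt', σ', hσ', hint', hsort'⟩, hGmin'⟩ := hG'
  have hmK : m * K ≠ 0 := Nat.mul_ne_zero hm hK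
  have hd := hGt.isTreeSequence hmK σ₀ hσ₀ hint₀
  have hd' := hGt'.isTreeSequence hmK σ' hσ' hint'
  have hnlt := hd.lt_card hK
  obtain ⟨f, hfnn, hfne, hfz, hfE⟩ := exists_nonneg_minimizer_energy hGt hK
    ⟨σ₀ 0, (hint₀ 0).mp hn₀⟩
  obtain ⟨σ, hint, hanti⟩ := exists_sorted_equiv σ₀ hint₀ hfnn hfz
  obtain ⟨par, hmono, hc⟩ := hd.exists_par
  obtain ⟨par', hmono', hc'⟩ := hd'.exists_par
  have hpar := hd.par_lt_childIdx hn₀ hmono hc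
  have hpar' := hd'.par_lt_childIdx hn₀ hmono' hc'
  have hle : ∀ b, par b ≤ par' b := by
    refine le_of_forall_sum_Iic_le hd.one_le hd'.one_le hmono hmono' hc hc' fun i => ?_
    by_cases hi : (i : ℕ) + 2 ≤ m * K + 1
    · exact hmaj.1 i hi
    · have : Finset.Iic i = Finset.univ := by
        ext j
        simp only [Finset.mem_Iic, Finset.mem_univ, iff_true]
        rw [Fin.le_def]
        omega
      rw [this]
      exact hmaj.2.le
  have hK' : (0 : ℝ) < K := by exact_mod_cast Nat.pos_of_ne_zero hK
  set g : Fin (m * K + 1) → ℝ := f ∘ σ with hg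
  have hgz : ∀ i : Fin (m * K + 1), n₀ ≤ i → g i = 0 := fun i hi =>
    hfz _ fun h => absurd ((hint i).mpr h) (not_lt.mpr hi)
  have hg0 : 0 < g 0 := by
    refine lt_of_le_of_ne (hfnn _) fun h => hfne ?_
    funext v
    refine le_antisymm ?_ (hfnn v)
    have h1 := hanti (Fin.zero_le (σ.symm v))
    rw [← h] at h1
    simpa [g] using h1
  have hsum : ∑ v, f v ^ 2 = ∑ i, g i ^ 2 := (Equiv.sum_comp σ fun v => f v ^ 2).symm
  have hpos : 0 < ∑ i, g i ^ 2 :=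
    Finset.sum_pos' (fun i _ => sq_nonneg _) ⟨0, Finset.mem_univ _, by positivity⟩
  set a : Fin m × Fin K → ℝ := g ∘ childIdx with ha
  -- The block tree for `π`.
  have hTmem := hd.blockTree_mem (σ := σ) hK hn₀ hmono hc hsort
  have hTint := hd.mem_interior_iff (σ := σ) hK hn₀ hmono hc
  have hTz : ∀ u ∉ (blockTree σ par).interior, f u = 0 := fun u hu => hfz u fun h => hu (by
    have h1 := (hTint (σ.symm u)).mp ((hint _).mpr (by simpa using h))
    simpa using h1)
  have hTE : K * (f ⬝ᵥ (blockTree σ par).lapMatrix.mulVec f) = familyEnergy (g ∘ par) a :=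
    (blockTree_isRootedBy hK hpar).mul_dotProduct_lapMatrix hK f
  -- Minimality of `G` and the rearrangement bound are opposite inequalities, so the block tree
  -- shares the eigenvalue and `f` attains it there.
  have t1 := hGmin _ hTmem
  have t2 := firstDirichletEigenvalue_mul_le _ ⟨σ 0, (hTint 0).mp hn₀⟩ hTz
  have t3 := hGt.exists_energy_le hK hd hn₀ hsort hσ₀ hint₀ hint hanti hmono hc
  change familyEnergy (g ∘ par) a ≤ _ at t3
  have t4 := le_of_mul_le_mul_left (hTE.trans_le t3) hK'
  rw [hsum] at t2 hfE
  have t5 : (blockTree σ par).firstDirichletEigenvalue = G.firstDirichletEigenvalue :=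
    le_antisymm (le_of_mul_le_mul_right (t2.trans (t4.trans hfE)) hpos) t1
  have t6 : f ⬝ᵥ (blockTree σ par).lapMatrix.mulVec f =
      G.firstDirichletEigenvalue * ∑ i, g i ^ 2 :=
    le_antisymm (t4.trans hfE) (t5 ▸ t2)
  have hgT : IsBlockEigenfunction n₀ par G.firstDirichletEigenvalue g := by
    refine blockTree_isBlockEigenfunction hK hpar fun i hi => ?_
    rw [← t5]
    refine lapMatrix_mulVec_eq_of_minimizer _ ⟨σ 0, (hTint 0).mp hn₀⟩ hTz ?_ _ ((hTint i).mp hi)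
    rw [t5, t6, hsum]
  -- The block tree for `π'`.
  by_contra hlt
  rw [not_lt] at hlt
  -- Only the values by position enter the energy, so `g` can be placed on `V'` along any numbering
  -- with the interior vertices first.
  set f' : V' → ℝ := g ∘ σ'.symm with hf'
  have hf'σ : f' ∘ σ' = g := by funext i; simp [f']
  have hsum' : ∑ v, f' v ^ 2 = ∑ i, g i ^ 2 := Equiv.sum_comp σ'.symm fun i => g i ^ 2
  have hTmem' := hd'.blockTree_mem (σ := σ') hK hn₀ hmono' hc' hsort'
  have hTint' := hd'.mem_interior_iff (σ := σ') hK hn₀ hmono' hc'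
  have hTz' : ∀ u ∉ (blockTree σ' par').interior, f' u = 0 := fun u hu =>
    hgz _ (not_lt.mp fun h => hu (by simpa using (hTint' (σ'.symm u)).mp h))
  have hTE' : K * (f' ⬝ᵥ (blockTree σ' par').lapMatrix.mulVec f') = familyEnergy (g ∘ par') a := by
    rw [(blockTree_isRootedBy hK hpar').mul_dotProduct_lapMatrix hK f', ← Function.comp_assoc,
      ← Function.comp_assoc, hf'σ]
  have u1 := hGmin' _ hTmem'
  have u2 := firstDirichletEigenvalue_mul_le _ ⟨σ' 0, (hTint' 0).mp hn₀⟩ hTz'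
  have u3 := familyEnergy_add_le (P := g ∘ par) (P' := g ∘ par') (a := a)
    (fun b => hanti (hle b)) (fun b s => hanti (hpar' b s).le)
  rw [← hTE, ← hTE', t6, ← mul_add] at u3
  have u4 := le_of_mul_le_mul_left u3 hK'
  have u5 : 0 ≤ ∑ b, ((g ∘ par) b - (g ∘ par') b) ^ 2 := Finset.sum_nonneg fun b _ => sq_nonneg _
  rw [hsum'] at u2
  have u6 : (blockTree σ' par').firstDirichletEigenvalue = G.firstDirichletEigenvalue :=
    le_antisymm (le_of_mul_le_mul_right (by linarith) hpos) (hlt.trans u1)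
  rw [u6] at u2
  -- Equal eigenvalues leave no room for the gap `K ∑ (P - P')²`.
  have hP : ∀ b, g (par b) = g (par' b) := by
    have h0 : ∑ b, ((g ∘ par) b - (g ∘ par') b) ^ 2 = 0 := le_antisymm (by linarith) u5
    intro b
    have h1 := (Finset.sum_eq_zero_iff_of_nonneg fun b _ => sq_nonneg _).mp h0 b (Finset.mem_univ b)
    exact sub_eq_zero.mp (pow_eq_zero_iff two_ne_zero |>.mp h1)
  have hgT' : IsBlockEigenfunction n₀ par' G.firstDirichletEigenvalue g := by
    rw [← hf'σ]
    refine blockTree_isBlockEigenfunction hK hpar' fun i hi => ?_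
    rw [← u6]
    refine lapMatrix_mulVec_eq_of_minimizer _ ⟨σ' 0, (hTint' 0).mp hn₀⟩ hTz' ?_ _
      ((hTint' i).mp hi)
    rw [u6, hsum']
    exact le_antisymm (by linarith) u2
  have hpp := hgT.par_eq hK hgT' hanti hg0 hgz hnlt hpar hpar' (hd.par_lt_interior hn₀ hc) hmono'
    hle hP
  refine hne (funext fun i => ?_)
  have h1 := (hc i).symm.trans (hpp ▸ hc' i)
  have h2 := hd.one_le i
  have h3 := hd'.one_le i
  simp only [childCount] at h1
  split_ifs at h1 <;> omega

end Hypergraph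

theorem mainTheorem3 {V V' : Type*} [Fintype V] [Fintype V'] (k n n₀ : ℕ) (hk : 2 ≤ k)
    (π π' : Fin n → ℕ) (G : Hypergraph V) (G' : Hypergraph V')
    (hG : G.HasFaberKrahnProperty (Hypergraph.supertreesOfDegreeSequence V k n₀ π))
    (hG' : G'.HasFaberKrahnProperty (Hypergraph.supertreesOfDegreeSequence V' k n₀ π'))
    (hmaj : IsMajorizedBy π' π) (hne : π ≠ π') :
    G'.firstDirichletEigenvalue < G.firstDirichletEigenvalue := by
  obtain ⟨K, rfl⟩ : ∃ K, k = K + 1 := ⟨k - 1, by omega⟩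
  have hK : K ≠ 0 := by omega
  obtain ⟨⟨hGt, σ, hσ, hint, -⟩, -⟩ := id hG
  obtain ⟨⟨hGt', σ', hσ', hint', -⟩, -⟩ := id hG'
  obtain ⟨r, -⟩ := hGt.connected.1
  obtain ⟨m, par, ch, h⟩ := hGt.exists_isRootedBy r
  obtain rfl : n = m * K + 1 := by
    rw [← h.card_eq, ← Fintype.card_congr σ, Fintype.card_fin]
  -- Without edges the single degree is fixed by the total; without interior vertices all degrees
  -- are one. Either way `π = π'`.
  have hm : m ≠ 0 := by
    rintro rfl
    have : Subsingleton (Fin (0 * K + 1)) := by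
      rw [Nat.zero_mul]; exact inferInstanceAs (Subsingleton (Fin 1))
    refine hne (funext fun i => ?_)
    have h1 := hmaj.2
    rw [Fintype.sum_subsingleton _ i, Fintype.sum_subsingleton _ i] at h1
    exact h1.symm
  have hn₀ : 0 < n₀ := by
    by_contra h0
    refine hne (funext fun i => ?_)
    rw [← hσ, ← hσ']
    have h1 : σ i ∉ G.interior := fun h => h0 (Nat.zero_lt_of_lt ((hint i).mpr h))
    have h2 : σ' i ∉ G'.interior := fun h => h0 (Nat.zero_lt_of_lt ((hint' i).mpr h))
    rw [hGt.degree_eq_one h1, hGt'.degree_eq_one h2]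
  exact Hypergraph.firstDirichletEigenvalue_lt_of_isMajorizedBy hK hm hn₀ hG hG' hmaj hne
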